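/- **Lemma 3.1 (uniform convergence).** There is a universal constant $C_0>0$, and for every $V$ a constant $C>0$ depending only on $V$, such that the following holds. Let $1\le d<D$, let $M\subset\mathbb{R}^D$ be a compact $d$-dimensional smooth embedded submanifold without boundary, with $d$-dimensional volume $\mathrm{vol}_d(M)\le V$ and condition number $1/\tau$ (that is, $\tau$ is the largest number such that for every $r<\tau$ the open normal bundle of radius $r$ about $M$ is embedded in $\mathbb{R}^D$ by $(p,v)\mapsto p+v$). Let $P$ be a Borel probability measure on $\mathbb{R}^D$ with $P(M)=1$, let $s>0$, let $\mathcal N\subseteq M$ be a minimum $s$-net of $M$ (a set of least cardinality such that every point of $M$ is at distance at most $s$ from some point of $\mathcal N$), let $n\ge1$, and put $$\mu := 1+\log n+\log|\mathcal N| .$$ (a) If $s\le 2\tau$, then $\mu\le C d+\log(1/v_d)+\log n+d\log(1/s)$, where $v_d$ is the volume of the unit ball of $\mathbb{R}^d$. (b) Let $k\ge\mu$ be a real number and let $\delta>0$. Let $\mathbf X=(X_1,\dots,X_n)$ be an i.i.d. sample from $P$, write $P_n(B)=\frac1n|\{i : X_i\in B\}|$, and put $C_\delta:=2C_0\log(2/\delta)$.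 Then with probability $>1-\delta$ the following three implications hold simultaneously for every ball $B$ (open or closed, of any radius $r\ge0$) centred at a point of $\mathcal N$ or at one of the sample points $X_1,\dots,X_n$: $$P(B)\ge\frac{C_\delta\,\mu}{n}\ \Longrightarrow\ P_n(B)>0,$$ $$P(B)\ge\frac kn+\frac{C_\delta}{n}\sqrt{k\mu}\ \Longrightarrow\ P_n(B)\ge\frac kn,$$ $$P(B)\le\frac kn-\frac{C_\delta}{n}\sqrt{k\mu}\ \Longrightarrow\ P_n(B)<\frac kn .$$ -/

import Mathlib

open MeasureTheory
open scoped NNReal ENNReal ContDiff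

namespace ManifoldBalls

/-- `M` is a compact `d`-dimensional smooth submanifold of `ℝ^D`, embedded and without boundary:
near each of its points it is the zero set of a smooth map into `ℝ^(D-d)` whose derivative at the
point is onto. It need not be connected. -/
def IsCompactSubmanifold {D : ℕ} (d : ℕ) (M : Set (EuclideanSpace ℝ (Fin D))) : Prop :=
  IsCompact M ∧ d ≤ D ∧
    ∀ p ∈ M, ∃ (U : Set (EuclideanSpace ℝ (Fin D)))
      (g : EuclideanSpace ℝ (Fin D) → EuclideanSpace ℝ (Fin (D - d))),
      IsOpen U ∧ p ∈ U ∧ ContDiffOn ℝ ∞ g U ∧ Function.Surjective (fderiv ℝ g p) ∧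
        M ∩ U = {x ∈ U | g x = 0}

/-- The normal space of `M` at `p`: the orthogonal complement of the tangent space. -/
noncomputable def normalSpace {D : ℕ} (M : Set (EuclideanSpace ℝ (Fin D)))
    (p : EuclideanSpace ℝ (Fin D)) : Submodule ℝ (EuclideanSpace ℝ (Fin D)) :=
  (Submodule.span ℝ (tangentConeAt ℝ M p))ᗮ

/-- The open normal bundle of radius `r` about `M`, as a set of pairs (foot point, normal vector). -/
def normalBundle {D : ℕ} (M : Set (EuclideanSpace ℝ (Fin D))) (r : ℝ) :
    Set (EuclideanSpace ℝ (Fin D) × EuclideanSpace ℝ (Fin D)) :=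
  {q | q.1 ∈ M ∧ q.2 ∈ normalSpace M q.1 ∧ ‖q.2‖ < r}

/-- The open normal bundle of radius `r` is embedded in `ℝ^D` by `(p, v) ↦ p + v`. -/
def NormalBundleEmbedded {D : ℕ} (M : Set (EuclideanSpace ℝ (Fin D))) (r : ℝ) : Prop :=
  Topology.IsEmbedding (fun q : normalBundle M r => q.1.1 + q.1.2)

/-- `M` has condition number `1 / τ`: `τ` is the largest number such that the open normal bundle
of radius `r` is embedded for every `r < τ`. -/
def HasConditionNumberInv {D : ℕ} (M : Set (EuclideanSpace ℝ (Fin D))) (τ : ℝ) : Prop :=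
  IsGreatest {t : ℝ | ∀ r < t, NormalBundleEmbedded M r} τ

/-- `N` is a minimum `s`-net of `M`: a subset of `M`, with every point of `M` at distance at most
`s` from it, of the least possible cardinality. -/
def IsMinNet {D : ℕ} (s : ℝ≥0) (M : Set (EuclideanSpace ℝ (Fin D)))
    (N : Finset (EuclideanSpace ℝ (Fin D))) : Prop :=
  (N : Set (EuclideanSpace ℝ (Fin D))) ⊆ M ∧
    Metric.IsCover s M (N : Set (EuclideanSpace ℝ (Fin D))) ∧
    (N.card : ℕ∞) = Metric.coveringNumber s M

/-- The volume `v_d` of the unit ball of `ℝ^d`. -/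
noncomputable def unitBallVolume (d : ℕ) : ℝ :=
  (volume : Measure (EuclideanSpace ℝ (Fin d))).real (Metric.ball 0 1)

/-- The balls, closed or open, whose centres are sample points or net points. -/
def sampleNetBalls {D n : ℕ} (N : Finset (EuclideanSpace ℝ (Fin D)))
    (x : Fin n → EuclideanSpace ℝ (Fin D)) : Set (Set (EuclideanSpace ℝ (Fin D))) :=
  {B | ∃ z, (z ∈ N ∨ z ∈ Set.range x) ∧ ∃ r : ℝ, 0 ≤ r ∧
    (B = Metric.closedBall z r ∨ B = Metric.ball z r)}

/-- The empirical measure `P_n(B)`: the fraction of the sample `x` that lies in `B`. -/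
noncomputable def empirical {D n : ℕ} (x : Fin n → EuclideanSpace ℝ (Fin D))
    (B : Set (EuclideanSpace ℝ (Fin D))) : ℝ :=
  (∑ i, B.indicator (fun _ => (1 : ℝ)) (x i)) / n

/-- `μ = 1 + log n + log |N|`. -/
noncomputable def muParam {D : ℕ} (n : ℕ) (N : Finset (EuclideanSpace ℝ (Fin D))) : ℝ :=
  1 + Real.log n + Real.log N.card

/-- `C_δ = 2 C₀ log (2 / δ)`. -/
noncomputable def confConst (C₀ δ : ℝ) : ℝ := 2 * C₀ * Real.log (2 / δ)

/-- The three implications for the balls centred at the points of the sample `x` and of the net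
`N`, with `c` in the role of `C_δ`. -/
def UniformConvergence {D n : ℕ} (P : Measure (EuclideanSpace ℝ (Fin D)))
    (N : Finset (EuclideanSpace ℝ (Fin D))) (x : Fin n → EuclideanSpace ℝ (Fin D))
    (k μ c : ℝ) : Prop :=
  ∀ B ∈ sampleNetBalls N x,
    (c * μ / n ≤ P.real B → 0 < empirical x B) ∧
    (k / n + c / n * Real.sqrt (k * μ) ≤ P.real B → k / n ≤ empirical x B) ∧
    (P.real B ≤ k / n - c / n * Real.sqrt (k * μ) → empirical x B < k / n)

end ManifoldBalls

/-! The two assertions are independent.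

For (a), a minimum net is no larger than a maximal packing of scale `s`. Balls of radius comparable
to `s` about the packing points are disjoint, so it suffices that each contains a definite share of
the volume of `M`. Injectivity of the normal bundle map makes every point the nearest point of `M`
to its short normal translates. Hence a chord has a normal part at most quadratic in its length,
with constant `1 / (2τ)` (`two_mul_inner_le`). Given transversality of nearby tangent and normal
spaces, the projection of `M` near `p` to the tangent space at `p` is open, and it covers a ball by
connectedness (`ball_subset_image`). Projection is 1-Lipschitz, which yields the volume bound.
Transversality is known at first only at an uncontrolled scale, from compactness; the chord
inequality allows that scale to be doubled repeatedly up to `τ / 26` (`two_mul`). No curvature is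
used.

For (b), balls about one centre are nested, so all radii are handled at once: every ball of measure
at most `t` lies in one set of measure at most `t` (`outerCore`), and every ball of measure at least
`t` contains one set of measure at least `t` (`innerCore`). A Chernoff bound for these sets replaces
any VC argument. When the centre is a sample point, the remaining entries are still i.i.d. given
that point, and the omitted entry changes a count by at most one. A union bound over the centres
costs at most `2 exp (μ - 1)`, which the tails absorb. -/

namespace ManifoldBalls
open Filter Topology
open scoped RealInnerProductSpace

/-! ### Local equations, tangent spaces and normal spaces -/

section Charts

variable {D m : ℕ} {M : Set (EuclideanSpace ℝ (Fin D))}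
  {g : EuclideanSpace ℝ (Fin D) → EuclideanSpace ℝ (Fin m)} {p q : EuclideanSpace ℝ (Fin D)}

/-- The tangent space of `M` at `p`. -/
noncomputable def tangentSpace (M : Set (EuclideanSpace ℝ (Fin D)))
    (p : EuclideanSpace ℝ (Fin D)) : Submodule ℝ (EuclideanSpace ℝ (Fin D)) :=
  Submodule.span ℝ (tangentConeAt ℝ M p)

theorem normalSpace_eq_orthogonal (M : Set (EuclideanSpace ℝ (Fin D)))
    (p : EuclideanSpace ℝ (Fin D)) : normalSpace M p = (tangentSpace M p)ᗮ := rfl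

/-- `g` is a regular local equation of `M` near `p`. -/
structure IsLocalEquation (M : Set (EuclideanSpace ℝ (Fin D)))
    (g : EuclideanSpace ℝ (Fin D) → EuclideanSpace ℝ (Fin m))
    (p : EuclideanSpace ℝ (Fin D)) : Prop where
  hasStrictFDerivAt : HasStrictFDerivAt g (fderiv ℝ g p) p
  surjective : Function.Surjective (fderiv ℝ g p)
  apply_eq_zero : g p = 0
  mem_iff : ∀ᶠ x in 𝓝 p, (x ∈ M ↔ g x = 0)

/-- The derivative carries the tangent cone of `M` into that of a single point, which is zero.
Conversely the implicit function parametrizes `M` near `p` with derivative the inclusion of the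
kernel. -/
theorem IsLocalEquation.tangentSpace_eq (h : IsLocalEquation M g p) :
    tangentSpace M p = (fderiv ℝ g p).ker := by
  have hr : (fderiv ℝ g p).range = ⊤ := LinearMap.range_eq_top.2 h.surjective
  apply le_antisymm
  · refine Submodule.span_le.2 fun w hw => ?_
    have hw' : w ∈ tangentConeAt ℝ (M ∩ {x | x ∈ M ↔ g x = 0}) p := by
      rwa [tangentConeAt_congr (t := M)]
      exact nhdsWithin_inter_of_mem' (mem_nhdsWithin_of_mem_nhds h.mem_iff)
    have h1 := (h.hasStrictFDerivAt.hasFDerivAt.hasFDerivWithinAt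
      (s := M ∩ {x | x ∈ M ↔ g x = 0})).mapsTo_tangent_cone hw'
    have h2 : g '' (M ∩ {x | x ∈ M ↔ g x = 0}) ⊆ {g p} := by
      rintro _ ⟨x, ⟨hx, hx'⟩, rfl⟩
      rw [Set.mem_singleton_iff, h.apply_eq_zero]
      exact hx'.1 hx
    have h3 := tangentConeAt_mono h2 h1
    have h4 := tangentConeAt_subset_zero (𝕜 := ℝ) (s := {g p}) (x := g p) (by
      rw [AccPt, Filter.not_neBot, principal_singleton, nhdsWithin, inf_assoc, ← principal_singleton,
        inf_principal, Set.compl_inter_self, principal_empty, inf_bot_eq]) h3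
    simpa using h4
  · intro w hw
    apply Submodule.subset_span
    set φ := h.hasStrictFDerivAt.implicitFunction g (fderiv ℝ g p) hr (g p)
    have hφ0 : φ 0 = p := h.hasStrictFDerivAt.implicitFunction_apply_image hr
    have hφ : HasStrictFDerivAt φ (fderiv ℝ g p).ker.subtypeL 0 :=
      h.hasStrictFDerivAt.to_implicitFunction hr
    have hev : ∀ᶠ z in 𝓝 (0 : (fderiv ℝ g p).ker), φ z ∈ M := by
      have h1 := h.hasStrictFDerivAt.map_implicitFunction_eq hr
      rw [nhds_prod_eq] at h1
      have h2 := h1.curry.self_of_nhds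
      have h3 : Tendsto φ (𝓝 0) (𝓝 p) := by
        have := hφ.continuousAt.tendsto
        rwa [hφ0] at this
      filter_upwards [h2, h3.eventually h.mem_iff] with z hz hz'
      rw [hz', ← h.apply_eq_zero]
      exact hz
    have hw' : (⟨w, hw⟩ : (fderiv ℝ g p).ker) ∈ tangentConeAt ℝ (φ ⁻¹' M) 0 := by
      rw [tangentConeAt_of_mem_nhds (show φ ⁻¹' M ∈ 𝓝 0 from hev)]
      trivial
    have h1 := (hφ.hasFDerivAt.hasFDerivWithinAt (s := φ ⁻¹' M)).mapsTo_tangent_cone hw'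
    rw [hφ0] at h1
    exact tangentConeAt_mono (Set.image_preimage_subset _ _) h1

theorem IsLocalEquation.finrank_tangentSpace (h : IsLocalEquation M g p) :
    Module.finrank ℝ (tangentSpace M p) + m = D := by
  have h1 := (fderiv ℝ g p).toLinearMap.finrank_range_add_finrank_ker
  rw [LinearMap.range_eq_top.2 h.surjective, finrank_top, finrank_euclideanSpace_fin,
    finrank_euclideanSpace_fin] at h1
  rw [h.tangentSpace_eq, add_comm]
  exact h1

/-- Lagrange multipliers for the squared distance to `a`; surjectivity of the derivative excludes a
vanishing multiplier `Λ₀`. -/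
theorem IsLocalEquation.sub_mem_normalSpace (h : IsLocalEquation M g p)
    {a : EuclideanSpace ℝ (Fin D)} (hmin : ∀ x ∈ M, dist p a ≤ dist x a) :
    a - p ∈ normalSpace M p := by
  have hφ : HasStrictFDerivAt (fun x => ‖x - a‖ ^ 2)
      ((2 • innerSL ℝ (p - a)).comp (ContinuousLinearMap.id ℝ (EuclideanSpace ℝ (Fin D)))) p :=
    (hasStrictFDerivAt_norm_sq (p - a)).comp p
      (HasStrictFDerivAt.sub_const a (hasStrictFDerivAt_id p))
  have hext : IsLocalExtrOn (fun x => ‖x - a‖ ^ 2) {x | g x = g p} p := by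
    left
    filter_upwards [self_mem_nhdsWithin, mem_nhdsWithin_of_mem_nhds h.mem_iff] with x hx hx'
    have hxM : x ∈ M := hx'.2 (hx.trans h.apply_eq_zero)
    have := hmin x hxM
    rw [dist_eq_norm, dist_eq_norm] at this
    gcongr
  obtain ⟨Λ, Λ₀, hne, hΛ⟩ := hext.exists_linear_map_of_hasStrictFDerivAt h.hasStrictFDerivAt hφ
  have h0 : Λ₀ ≠ 0 := by
    rintro rfl
    apply hne
    refine Prod.ext (LinearMap.ext fun y => ?_) rfl
    obtain ⟨x, rfl⟩ := h.surjective y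
    simpa using hΛ x
  rw [normalSpace_eq_orthogonal, h.tangentSpace_eq, Submodule.mem_orthogonal]
  intro w hw
  have h1 := hΛ w
  have hw' : fderiv ℝ g p w = 0 := hw
  rw [hw', map_zero, zero_add, smul_eq_mul] at h1
  have h2 := (mul_eq_zero.1 h1).resolve_left h0
  have h3 : ⟪p - a, w⟫ = 0 := by simpa [inner_sub_left] using h2
  rw [real_inner_comm, ← neg_sub, inner_neg_left, h3, neg_zero]

/-- The orthogonal projection to `T_p` is open on `M` at `q` if `T_q` is transverse to `N_p`. -/
theorem IsLocalEquation.image_orthogonalProjection_mem_nhds (h : IsLocalEquation M g q)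
    {T : Submodule ℝ (EuclideanSpace ℝ (Fin D))} (hT : Module.finrank ℝ T + m = D)
    (hd : tangentSpace M q ⊓ Tᗮ = ⊥) {W : Set (EuclideanSpace ℝ (Fin D))} (hW : W ∈ 𝓝 q) :
    (fun x => T.orthogonalProjectionOnto x) '' (M ∩ W) ∈ 𝓝 (T.orthogonalProjectionOnto q) := by
  -- The kernel of `G'` is `T_q ⊓ Tᗮ = ⊥` and the dimensions agree, so `(g, π)` is open at `q`.
  -- Slicing at `g = 0` gives the claim on `M`.
  set G' := (fderiv ℝ g q).prod T.orthogonalProjectionOnto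
  have hG : HasStrictFDerivAt (fun x => (g x, T.orthogonalProjectionOnto x)) G' q :=
    h.hasStrictFDerivAt.prodMk T.orthogonalProjectionOnto.hasStrictFDerivAt
  have hinj : Function.Injective G'.toLinearMap := by
    rw [← LinearMap.ker_eq_bot, eq_bot_iff, ← hd, h.tangentSpace_eq]
    intro x hx
    have hx' : (fderiv ℝ g q x, T.orthogonalProjectionOnto x) = 0 := hx
    rw [Prod.mk_eq_zero] at hx'
    exact ⟨hx'.1, by rw [← Submodule.ker_orthogonalProjectionOnto]; exact hx'.2⟩
  have hsurj : G'.range = ⊤ := by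
    apply LinearMap.range_eq_top.2
    refine (LinearMap.injective_iff_surjective_of_finrank_eq_finrank ?_).1 hinj
    rw [Module.finrank_prod, finrank_euclideanSpace_fin, finrank_euclideanSpace_fin]
    omega
  have hmap := hG.map_nhds_eq_of_surj hsurj
  have h1 : W ∩ {x | x ∈ M ↔ g x = 0} ∈ 𝓝 q := inter_mem hW h.mem_iff
  have h2 := image_mem_map (m := fun x => (g x, T.orthogonalProjectionOnto x)) h1
  rw [hmap, h.apply_eq_zero] at h2
  have h3 : Tendsto (fun y : T => ((0 : EuclideanSpace ℝ (Fin m)), y))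
      (𝓝 (T.orthogonalProjectionOnto q)) (𝓝 (0, T.orthogonalProjectionOnto q)) :=
    (Continuous.prodMk_right 0).tendsto _
  filter_upwards [h3 h2] with y hy
  obtain ⟨x, ⟨hxW, hx⟩, hxy⟩ := hy
  rw [Prod.mk.injEq] at hxy
  exact ⟨x, ⟨hx.2 hxy.1, hxW⟩, hxy.2⟩

end Charts

/-! ### Consequences of the condition number -/

section Reach

variable {D d : ℕ} {M : Set (EuclideanSpace ℝ (Fin D))} {τ h : ℝ}

/-- Near each of its points a submanifold has a regular local equation, and its tangent spaces
there are pairwise transverse to its normal spaces. -/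
theorem IsCompactSubmanifold.exists_localEquation (hM : IsCompactSubmanifold d M)
    {p₀ : EuclideanSpace ℝ (Fin D)} (hp₀ : p₀ ∈ M) :
    ∃ g : EuclideanSpace ℝ (Fin D) → EuclideanSpace ℝ (Fin (D - d)),
      ∃ V : Set _, IsOpen V ∧ p₀ ∈ V ∧
      (∀ q ∈ M ∩ V, IsLocalEquation M g q) ∧
      ∀ p ∈ M ∩ V, ∀ q ∈ M ∩ V, tangentSpace M q ⊓ (tangentSpace M p)ᗮ = ⊥ := by
  obtain ⟨U, g, hU, hpU, hg, hsurj, hMU⟩ := hM.2.2 p₀ hp₀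
  have hcont : ContinuousOn (fderiv ℝ g) U := hg.continuousOn_fderiv_of_isOpen hU (by simp)
  -- `A (p, q) ≠ 0` is an open condition that holds at `(p₀, p₀)`. On the diagonal it gives
  -- surjectivity at `q`; off it, since `N_p` is the range of the adjoint at `p` and `T_q` the
  -- kernel at `q`, it gives transversality.
  set A : EuclideanSpace ℝ (Fin D) × EuclideanSpace ℝ (Fin D) → ℝ := fun z =>
    ((fderiv ℝ g z.2).comp (ContinuousLinearMap.adjoint (fderiv ℝ g z.1))).det
  have hker : ∀ p : EuclideanSpace ℝ (Fin D), (fderiv ℝ g p).kerᗮ =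
      (ContinuousLinearMap.adjoint (fderiv ℝ g p)).range := by
    intro p
    rw [ContinuousLinearMap.orthogonal_ker]
    exact (Submodule.closed_of_finiteDimensional _).submodule_topologicalClosure_eq
  have hA : ContinuousAt A (p₀, p₀) := by
    have h1 : ContinuousAt (fderiv ℝ g) p₀ := hcont.continuousAt (hU.mem_nhds hpU)
    have h2 : ContinuousAt (fun z : EuclideanSpace ℝ (Fin D) × EuclideanSpace ℝ (Fin D) =>
        fderiv ℝ g z.2) (p₀, p₀) := ContinuousAt.comp (x := (p₀, p₀)) h1 continuousAt_snd
    have h3 : ContinuousAt (fun z : EuclideanSpace ℝ (Fin D) × EuclideanSpace ℝ (Fin D) =>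
        ContinuousLinearMap.adjoint (fderiv ℝ g z.1)) (p₀, p₀) :=
      (ContinuousLinearMap.adjoint (𝕜 := ℝ)).continuous.continuousAt.comp
        (ContinuousAt.comp (x := (p₀, p₀)) h1 continuousAt_fst)
    exact ContinuousLinearMap.continuous_det.continuousAt.comp (h2.clm_comp h3)
  have hA0 : A (p₀, p₀) ≠ 0 := by
    have hinj : Function.Injective
        ((fderiv ℝ g p₀).comp (ContinuousLinearMap.adjoint (fderiv ℝ g p₀))).toLinearMap := by
      rw [injective_iff_map_eq_zero]
      intro y hy
      have hy' : fderiv ℝ g p₀ (ContinuousLinearMap.adjoint (fderiv ℝ g p₀) y) = 0 := hy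
      obtain ⟨x, rfl⟩ := hsurj y
      have h1 : ContinuousLinearMap.adjoint (fderiv ℝ g p₀) (fderiv ℝ g p₀ x) = 0 := by
        rw [← inner_self_eq_zero (𝕜 := ℝ), ContinuousLinearMap.adjoint_inner_left, hy',
          inner_zero_right]
      rw [← inner_self_eq_zero (𝕜 := ℝ), ← ContinuousLinearMap.adjoint_inner_left, h1,
        inner_zero_left]
    have := LinearMap.isUnit_iff_ker_eq_bot _ |>.2 (LinearMap.ker_eq_bot.2 hinj)
    exact ((LinearMap.isUnit_iff_isUnit_det _).1 this).ne_zero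
  have hinj : ∀ p q, A (p, q) ≠ 0 → Function.Bijective
      ((fderiv ℝ g q).comp (ContinuousLinearMap.adjoint (fderiv ℝ g p))).toLinearMap := by
    intro p q hpq
    exact (Module.End.isUnit_iff _).1 ((LinearMap.isUnit_iff_isUnit_det _).2
      (isUnit_iff_ne_zero.2 hpq))
  have hev := hA.eventually_ne hA0
  rw [nhds_prod_eq] at hev
  obtain ⟨t, ht, htA'⟩ := mem_prod_same_iff.1 hev
  have htA : ∀ p ∈ t, ∀ q ∈ t, A (p, q) ≠ 0 := fun p hp q hq => htA' ⟨hp, hq⟩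
  obtain ⟨V, hVt, hV, hpV⟩ := mem_nhds_iff.1 ht
  have hEq : ∀ q ∈ M ∩ (V ∩ U), IsLocalEquation M g q := by
    rintro q ⟨hqM, hqV, hqU⟩
    refine ⟨?_, ?_, ?_, ?_⟩
    · exact ((hg q hqU).contDiffAt (hU.mem_nhds hqU)).hasStrictFDerivAt (by simp)
    · intro y
      obtain ⟨x, hx⟩ := (hinj q q (htA _ (hVt hqV) _ (hVt hqV))).2 y
      exact ⟨_, hx⟩
    · exact (hMU.subset ⟨hqM, hqU⟩).2
    · filter_upwards [hU.mem_nhds hqU] with x hx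
      exact ⟨fun h => (hMU.subset ⟨h, hx⟩).2, fun h => (hMU.superset ⟨hx, h⟩).1⟩
  refine ⟨g, V ∩ U, hV.inter hU, ⟨hpV, hpU⟩, hEq, fun p hp q hq => ?_⟩
  rw [(hEq p hp).tangentSpace_eq, (hEq q hq).tangentSpace_eq, hker, eq_bot_iff]
  rintro _ ⟨hx, y, rfl⟩
  have h1 := (hinj p q (htA _ (hVt hp.2.1) _ (hVt hq.2.1))).1
  have h2 : y = 0 := h1 (by simpa using hx)
  simp [h2]

/-- Tangent spaces of `M` are transverse to normal spaces at points at distance at most `h`. -/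
def TransverseWithin (M : Set (EuclideanSpace ℝ (Fin D))) (h : ℝ) : Prop :=
  ∀ p ∈ M, ∀ q ∈ M, dist p q ≤ h → tangentSpace M q ⊓ (tangentSpace M p)ᗮ = ⊥

theorem IsCompactSubmanifold.exists_transverseWithin (hM : IsCompactSubmanifold d M) :
    ∃ η > 0, TransverseWithin M η := by
  choose! g V hV hpV hEq hT using fun p (hp : p ∈ M) => hM.exists_localEquation hp
  obtain ⟨δ, hδ, hδV⟩ := lebesgue_number_lemma_of_metric (c := fun p : M => V p) hM.1
    (fun p => hV p p.2) (fun p hp => Set.mem_iUnion.2 ⟨⟨p, hp⟩, hpV p hp⟩)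
  refine ⟨δ / 2, by positivity, fun p hp q hq hpq => ?_⟩
  obtain ⟨i, hi⟩ := hδV p hp
  refine hT i i.2 p ⟨hp, hi (Metric.mem_ball_self hδ)⟩ q ⟨hq, hi ?_⟩
  rw [Metric.mem_ball, dist_comm]
  linarith

theorem IsCompactSubmanifold.finrank_tangentSpace (hM : IsCompactSubmanifold d M)
    {p : EuclideanSpace ℝ (Fin D)} (hp : p ∈ M) : Module.finrank ℝ (tangentSpace M p) = d := by
  obtain ⟨g, V, -, hpV, hEq, -⟩ := hM.exists_localEquation hp
  have h1 := (hEq p ⟨hp, hpV⟩).finrank_tangentSpace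
  have h2 := hM.2.1
  omega

/-- If `x₀` is a nearest point of `M` to `q + w`, then `q + w - x₀` is normal at `x₀` and no longer
than `w`. Injectivity forces `x₀ = q`, and expanding `‖w‖ ≤ ‖x - q - w‖` gives the bound. -/
theorem HasConditionNumberInv.two_mul_inner_le_of_norm_lt (hτ : HasConditionNumberInv M τ)
    (hM : IsCompactSubmanifold d M) {q w x : EuclideanSpace ℝ (Fin D)} (hq : q ∈ M)
    (hw : w ∈ normalSpace M q) (hwτ : ‖w‖ < τ) (hx : x ∈ M) :
    2 * ⟪x - q, w⟫ ≤ ‖x - q‖ ^ 2 := by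
  obtain ⟨x₀, hx₀, hmin⟩ := hM.1.exists_isMinOn ⟨q, hq⟩
    (continuous_id.dist (continuous_const (y := q + w))).continuousOn
  have hmin' : ∀ y ∈ M, dist x₀ (q + w) ≤ dist y (q + w) := fun y hy => hmin hy
  obtain ⟨g, V, -, hpV, hEq, -⟩ := hM.exists_localEquation hx₀
  have hres := (hEq x₀ ⟨hx₀, hpV⟩).sub_mem_normalSpace hmin'
  obtain ⟨r, hwr, hrτ⟩ := exists_between hwτ
  have hinj := (hτ.1 r hrτ).injective
  have hnorm : ‖q + w - x₀‖ < r := by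
    have := hmin' q hq
    rw [dist_comm, dist_eq_norm, dist_eq_norm] at this
    have h2 : ‖q - (q + w)‖ = ‖w‖ := by rw [sub_add_cancel_left, norm_neg]
    linarith
  have heq := @hinj ⟨(x₀, q + w - x₀), hx₀, hres, hnorm⟩ ⟨(q, w), hq, hw, hwr⟩ (by simp)
  have hxq : x₀ = q := congrArg (fun z => z.1.1) heq
  have h1 := hmin' x hx
  rw [hxq, dist_eq_norm, dist_eq_norm, sub_add_cancel_left, norm_neg, ← sub_sub] at h1
  have h2 : ‖w‖ ^ 2 ≤ ‖x - q - w‖ ^ 2 := by gcongr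
  rw [norm_sub_sq_real] at h2
  linarith

/-- A normal vector makes only a quadratically small angle with the chords of `M`. -/
theorem HasConditionNumberInv.two_mul_inner_le (hτ : HasConditionNumberInv M τ)
    (hM : IsCompactSubmanifold d M) (hτ0 : 0 < τ) {q v x : EuclideanSpace ℝ (Fin D)} (hq : q ∈ M)
    (hv : v ∈ (tangentSpace M q)ᗮ) (hx : x ∈ M) :
    2 * τ * ⟪x - q, v⟫ ≤ ‖v‖ * ‖x - q‖ ^ 2 := by
  rcases eq_or_ne v 0 with rfl | hv0
  · simp
  have hn : 0 < ‖v‖ := norm_pos_iff.2 hv0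
  have key : ∀ r ∈ Set.Ioo 0 τ, 2 * r * ⟪x - q, v⟫ ≤ ‖v‖ * ‖x - q‖ ^ 2 := by
    intro r hr
    have h1 := hτ.two_mul_inner_le_of_norm_lt hM hq (w := (r / ‖v‖) • v)
      (Submodule.smul_mem _ _ hv) (by
        rw [norm_smul, norm_div, norm_norm, div_mul_cancel₀ _ hn.ne', Real.norm_of_nonneg hr.1.le]
        exact hr.2) hx
    rw [inner_smul_right] at h1
    calc 2 * r * ⟪x - q, v⟫ = ‖v‖ * (2 * (r / ‖v‖ * ⟪x - q, v⟫)) := by field_simp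
      _ ≤ _ := by gcongr
  -- The embedding is given only for radii below `τ`, so the endpoint is reached as a limit.
  have hc : Tendsto (fun r : ℝ => 2 * r * ⟪x - q, v⟫) (𝓝[<] τ) (𝓝 (2 * τ * ⟪x - q, v⟫)) := by
    apply Tendsto.mono_left _ nhdsWithin_le_nhds
    exact Continuous.tendsto (by fun_prop) τ
  refine le_of_tendsto hc ?_
  filter_upwards [Ioo_mem_nhdsLT hτ0] with r hr using key r hr

/-- Chords of length at most `τ` are at most twice as long as their tangential parts. -/
theorem HasConditionNumberInv.dist_le_two_mul (hτ : HasConditionNumberInv M τ)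
    (hM : IsCompactSubmanifold d M) (hτ0 : 0 < τ) {p x : EuclideanSpace ℝ (Fin D)} (hp : p ∈ M)
    (hx : x ∈ M) (hd : dist x p ≤ τ) :
    dist x p ≤ 2 * dist ((tangentSpace M p).orthogonalProjectionOnto x)
      ((tangentSpace M p).orthogonalProjectionOnto p) := by
  set T := tangentSpace M p
  set v := x - p - T.orthogonalProjectionOnto (x - p) with hv
  have hvT : v ∈ Tᗮ := T.sub_starProjection_mem_orthogonal (x - p)
  have h1 := hτ.two_mul_inner_le hM hτ0 hp hvT hx
  have hin : ⟪x - p, v⟫ = ‖v‖ ^ 2 := by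
    have : x - p = v + T.orthogonalProjectionOnto (x - p) := by simp [hv]
    rw [this, inner_add_left, real_inner_self_eq_norm_sq,
      Submodule.inner_right_of_mem_orthogonal (Submodule.coe_mem _) hvT, add_zero]
  rw [dist_eq_norm] at hd ⊢
  have hv2 : ‖v‖ ≤ ‖x - p‖ / 2 := by
    rcases eq_or_ne v 0 with hv0 | hv0
    · rw [hv0, norm_zero]; positivity
    have hn : 0 < ‖v‖ := norm_pos_iff.2 hv0
    rw [hin] at h1
    have h2 : 2 * τ * ‖v‖ ≤ ‖x - p‖ ^ 2 := by
      have : ‖v‖ * (2 * τ * ‖v‖) ≤ ‖v‖ * ‖x - p‖ ^ 2 := by linarith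
      exact le_of_mul_le_mul_left this hn
    have h3 : ‖x - p‖ ^ 2 ≤ τ * ‖x - p‖ := by
      rw [sq]; gcongr
    have h4 : τ * (2 * ‖v‖) ≤ τ * ‖x - p‖ := by linarith
    have := le_of_mul_le_mul_left h4 hτ0
    linarith
  have h5 : ‖x - p‖ ≤ ‖v‖ + ‖T.orthogonalProjectionOnto (x - p)‖ := by
    calc ‖x - p‖ = ‖v + T.orthogonalProjectionOnto (x - p)‖ := by simp [hv]
      _ ≤ _ := norm_add_le _ _
  rw [dist_eq_norm, ← map_sub]
  linarith

/-- In the ball, the image of `M ∩ ball p h` is open by transversality. It is also relatively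
closed: a limit comes from some `q` in the compact closed ball, and `dist_le_two_mul` puts `q`
strictly inside. Connectedness finishes. -/
theorem TransverseWithin.ball_subset_image (hh : TransverseWithin M h)
    (hτ : HasConditionNumberInv M τ) (hM : IsCompactSubmanifold d M) (h0 : 0 < h) (hhτ : h ≤ τ)
    {p : EuclideanSpace ℝ (Fin D)} (hp : p ∈ M) :
    Metric.ball ((tangentSpace M p).orthogonalProjectionOnto p) (h / 2) ⊆
      (fun x => (tangentSpace M p).orthogonalProjectionOnto x) '' (M ∩ Metric.closedBall p h) := by
  set T := tangentSpace M p
  set π : EuclideanSpace ℝ (Fin D) → T := fun x => T.orthogonalProjectionOnto x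
  have hπ : Continuous π := T.orthogonalProjectionOnto.continuous
  have hτ0 : 0 < τ := h0.trans_le hhτ
  set u := Metric.ball (π p) (h / 2) ∩ π '' (M ∩ Metric.ball p h)
  have hsub : Metric.ball (π p) (h / 2) ⊆ u := by
    refine (convex_ball (π p) (h / 2)).isPreconnected.subset_of_closure_inter_subset ?_ ?_ ?_
    · rw [isOpen_iff_mem_nhds]
      rintro _ ⟨hy, q, ⟨hq, hqp⟩, rfl⟩
      refine inter_mem (Metric.isOpen_ball.mem_nhds hy) ?_
      obtain ⟨g, V, -, hpV, hEq, -⟩ := hM.exists_localEquation hq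
      refine (hEq q ⟨hq, hpV⟩).image_orthogonalProjection_mem_nhds ?_ ?_
        (Metric.isOpen_ball.mem_nhds hqp)
      · rw [hM.finrank_tangentSpace hp]
        have := hM.2.1
        omega
      · exact hh p hp q hq (by rw [dist_comm]; exact (Metric.mem_ball.1 hqp).le)
    · exact ⟨π p, Metric.mem_ball_self (by positivity), Metric.mem_ball_self (by positivity), p,
        ⟨hp, Metric.mem_ball_self h0⟩, rfl⟩
    · rintro y ⟨hyu, hy⟩
      have hcl : IsClosed (π '' (M ∩ Metric.closedBall p h)) :=
        ((hM.1.inter_right Metric.isClosed_closedBall).image hπ).isClosed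
      have hu : u ⊆ π '' (M ∩ Metric.closedBall p h) :=
        Set.inter_subset_right.trans (Set.image_mono
          (Set.inter_subset_inter_right _ Metric.ball_subset_closedBall))
      obtain ⟨q, ⟨hq, hqp⟩, rfl⟩ := closure_minimal hu hcl hyu
      refine ⟨hy, q, ⟨hq, ?_⟩, rfl⟩
      have h1 := hτ.dist_le_two_mul hM hτ0 hp hq ((Metric.mem_closedBall.1 hqp).trans hhτ)
      have h2 : dist (π q) (π p) < h / 2 := hy
      rw [Metric.mem_ball]
      linarith
  intro y hy
  obtain ⟨q, ⟨hq, hqp⟩, rfl⟩ := (hsub hy).2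
  exact ⟨q, ⟨hq, Metric.ball_subset_closedBall hqp⟩, rfl⟩

/-- Let `u`, of length `h / 4`, be tangent at `q` and normal at `p`. Some `x ∈ M` within `h` of `q`
has `x - q` projecting to `u`, so `⟪x - q, u⟫ = h² / 16`. But `u` is normal at `p`, and the chords
`x - p`, `q - p` have lengths at most `3h`, `2h`. The chord inequality then gives `2τ h² / 16 ≤ (9 +
4) h³ / 4`, that is `τ ≤ 26 h`. -/
theorem TransverseWithin.two_mul (hh : TransverseWithin M h)
    (hτ : HasConditionNumberInv M τ) (hM : IsCompactSubmanifold d M) (h0 : 0 < h)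
    (hhτ : 26 * h < τ) : TransverseWithin M (2 * h) := by
  intro p hp q hq hpq
  rw [eq_bot_iff]
  rintro w ⟨hwq, hwp⟩
  by_contra hw
  have hn : 0 < ‖w‖ := norm_pos_iff.2 hw
  set T := tangentSpace M q
  set u : EuclideanSpace ℝ (Fin D) := (h / 4 / ‖w‖) • w
  have huT : u ∈ T := Submodule.smul_mem _ _ hwq
  have hun : ‖u‖ = h / 4 := by
    rw [norm_smul, Real.norm_of_nonneg (by positivity), div_mul_cancel₀ _ hn.ne']
  have huN : u ∈ (tangentSpace M p)ᗮ := Submodule.smul_mem _ _ hwp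
  obtain ⟨x, ⟨hx, hxq⟩, hxu⟩ := hh.ball_subset_image hτ hM h0 (by linarith) hq
    (a := T.orthogonalProjectionOnto q + ⟨u, huT⟩) (by
      rw [Metric.mem_ball, dist_self_add_left, Submodule.coe_norm, hun]; linarith)
  have hτ0 : 0 < τ := by linarith
  have hxu' : T.orthogonalProjectionOnto (x - q) = ⟨u, huT⟩ := by
    rw [map_sub, sub_eq_iff_eq_add']; exact hxu
  have hin : ⟪x - q, u⟫ = (h / 4) ^ 2 := by
    have h1 : ⟪T.orthogonalProjectionOnto (x - q), (⟨u, huT⟩ : T)⟫ = ⟪x - q, u⟫ :=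
      Submodule.inner_orthogonalProjectionOnto_eq_of_mem_right ⟨u, huT⟩ (x - q)
    rw [← h1, hxu', Submodule.coe_inner, real_inner_self_eq_norm_sq, hun]
  have hxq' : ‖x - q‖ ≤ h := by rw [← dist_eq_norm]; exact hxq
  have hpq' : ‖q - p‖ ≤ 2 * h := by rw [← dist_eq_norm, dist_comm]; exact hpq
  have hxp : ‖x - p‖ ≤ 3 * h := by
    calc ‖x - p‖ = ‖(x - q) + (q - p)‖ := by rw [sub_add_sub_cancel]
      _ ≤ _ := (norm_add_le _ _).trans (by linarith)
  have h1 := hτ.two_mul_inner_le hM hτ0 hp huN hx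
  have h2 := hτ.two_mul_inner_le hM hτ0 hp (Submodule.neg_mem _ huN) hq
  rw [inner_neg_right, norm_neg] at h2
  have h3 : ⟪x - q, u⟫ = ⟪x - p, u⟫ - ⟪q - p, u⟫ := by
    rw [← inner_sub_left, sub_sub_sub_cancel_right]
  have h4 : ‖x - p‖ ^ 2 ≤ (3 * h) ^ 2 := by gcongr
  have h5 : ‖q - p‖ ^ 2 ≤ (2 * h) ^ 2 := by gcongr
  rw [hun] at h1 h2
  have h6 : 2 * τ * (h / 4) ^ 2 ≤ h / 4 * (3 * h) ^ 2 + h / 4 * (2 * h) ^ 2 := by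
    calc 2 * τ * (h / 4) ^ 2 = 2 * τ * ⟪x - p, u⟫ + 2 * τ * -⟪q - p, u⟫ := by
          rw [← hin, h3]; ring
      _ ≤ h / 4 * ‖x - p‖ ^ 2 + h / 4 * ‖q - p‖ ^ 2 := add_le_add h1 h2
      _ ≤ _ := by gcongr
  have h7 : (h ^ 2 / 8) * τ ≤ (h ^ 2 / 8) * (26 * h) := by nlinarith
  have := le_of_mul_le_mul_left h7 (by positivity)
  linarith

theorem TransverseWithin.mono {h' : ℝ} (hh : TransverseWithin M h) (hle : h' ≤ h) :
    TransverseWithin M h' :=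
  fun p hp q hq hpq => hh p hp q hq (hpq.trans hle)

theorem HasConditionNumberInv.transverseWithin (hτ : HasConditionNumberInv M τ)
    (hM : IsCompactSubmanifold d M) (h0 : 0 < h) (hhτ : 26 * h ≤ τ) : TransverseWithin M h := by
  obtain ⟨η, hη, hT⟩ := hM.exists_transverseWithin
  have key : ∀ n : ℕ, ∀ h : ℝ, 0 < h → 26 * h ≤ τ → h ≤ 2 ^ n * η → TransverseWithin M h := by
    intro n
    induction n with
    | zero => intro h _ _ h2; exact hT.mono (by simpa using h2)
    | succ n ih =>
      intro h h0 h1 h2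
      have h3 : TransverseWithin M (h / 2) :=
        ih (h / 2) (by positivity) (by linarith) (by rw [pow_succ] at h2; linarith)
      have h4 := h3.two_mul hτ hM (by positivity) (by linarith)
      rwa [mul_div_cancel₀ _ two_ne_zero] at h4
  obtain ⟨n, hn⟩ := pow_unbounded_of_one_lt (h / η) (one_lt_two)
  exact key n h h0 hhτ ((div_lt_iff₀ hη).1 hn).le

end Reach

/-! ### Volume lower bounds and the size of a minimum net -/

section Volume

variable {D d : ℕ} {M : Set (EuclideanSpace ℝ (Fin D))} {τ h : ℝ}

theorem euclideanHausdorffMeasure_image_le {X Y : Type*} [EMetricSpace X] [MeasurableSpace X]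
    [BorelSpace X] [EMetricSpace Y] [MeasurableSpace Y] [BorelSpace Y] {f : X → Y}
    (hf : LipschitzWith 1 f) (d : ℕ) (s : Set X) :
    Measure.euclideanHausdorffMeasure d (f '' s) ≤ Measure.euclideanHausdorffMeasure d s := by
  rw [Measure.euclideanHausdorffMeasure_def, Measure.euclideanHausdorffMeasure_def,
    Measure.smul_apply, Measure.smul_apply]
  have h1 : Measure.hausdorffMeasure (d : ℝ) (f '' s) ≤ Measure.hausdorffMeasure (d : ℝ) s := by
    simpa using hf.hausdorffMeasure_image_le (d := d) (Nat.cast_nonneg d) s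
  gcongr

/-- Lower bound for the volume of a submanifold in a small ball about one of its points. -/
theorem HasConditionNumberInv.volume_ball_le (hτ : HasConditionNumberInv M τ)
    (hM : IsCompactSubmanifold d M) (h0 : 0 < h) (hhτ : 26 * h ≤ τ)
    {p : EuclideanSpace ℝ (Fin D)} (hp : p ∈ M) :
    volume (Metric.ball (0 : EuclideanSpace ℝ (Fin d)) (h / 2)) ≤
      Measure.euclideanHausdorffMeasure d (M ∩ Metric.closedBall p h) := by
  have hsub := (hτ.transverseWithin hM h0 hhτ).ball_subset_image hτ hM h0 (by linarith) hp
  have hfin := hM.finrank_tangentSpace hp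
  set T := tangentSpace M p
  have e : T ≃ₗᵢ[ℝ] EuclideanSpace ℝ (Fin d) :=
    ((stdOrthonormalBasis ℝ T).reindex (finCongr hfin)).repr
  have hlip : LipschitzWith 1 (fun x => e (T.orthogonalProjectionOnto x)) := by
    have h1 := e.lipschitz.comp T.lipschitzWith_orthogonalProjectionOnto
    rw [one_mul] at h1
    exact h1
  calc volume (Metric.ball (0 : EuclideanSpace ℝ (Fin d)) (h / 2))
      = volume (Metric.ball (e (T.orthogonalProjectionOnto p)) (h / 2)) :=
        (Measure.addHaar_ball_center _ _ _).symm
    _ = Measure.euclideanHausdorffMeasure d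
        (Metric.ball (e (T.orthogonalProjectionOnto p)) (h / 2)) := by
        rw [EuclideanSpace.euclideanHausdorffMeasure_eq_volume]
    _ = Measure.euclideanHausdorffMeasure d
        (e '' Metric.ball (T.orthogonalProjectionOnto p) (h / 2)) := by rw [e.image_ball]
    _ ≤ Measure.euclideanHausdorffMeasure d
        ((fun x => e (T.orthogonalProjectionOnto x)) '' (M ∩ Metric.closedBall p h)) := by
        gcongr
        rw [← Set.image_image (fun y => e y) (fun x => T.orthogonalProjectionOnto x)]
        exact Set.image_mono hsub
    _ ≤ _ := euclideanHausdorffMeasure_image_le hlip d _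

theorem unitBallVolume_pos (d : ℕ) : 0 < unitBallVolume d :=
  ENNReal.toReal_pos (Metric.measure_ball_pos _ _ one_pos).ne' measure_ball_lt_top.ne

theorem volume_ball_eq (hd : 1 ≤ d) {r : ℝ} (hr : 0 ≤ r) :
    volume (Metric.ball (0 : EuclideanSpace ℝ (Fin d)) r) =
      ENNReal.ofReal (r ^ d * unitBallVolume d) := by
  have : Nonempty (Fin d) := ⟨⟨0, hd⟩⟩
  rw [Measure.addHaar_ball _ _ hr, finrank_euclideanSpace_fin,
    ENNReal.ofReal_mul (by positivity), unitBallVolume, Measure.real,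
    ENNReal.ofReal_toReal measure_ball_lt_top.ne]

theorem _root_.IsCompact.packingNumber_ne_top {X : Type*} [PseudoEMetricSpace X] {A : Set X}
    (hA : IsCompact A) {s : ℝ≥0} (hs : 0 < s) : Metric.packingNumber s A ≠ ⊤ := by
  obtain ⟨t, -, ht, hcov⟩ := EMetric.totallyBounded_iff'.1 hA.totallyBounded
    ((s / 2 : ℝ≥0) : ℝ≥0∞) (by simpa using hs.ne')
  have h1 : Metric.IsCover (s / 2) A t := by
    intro x hx
    obtain ⟨y, hy, hxy⟩ := Set.mem_iUnion₂.1 (hcov hx)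
    exact ⟨y, hy, (Metric.mem_eball.1 hxy).le⟩
  have h2 : Metric.externalCoveringNumber (s / 2) A < ⊤ :=
    (iInf₂_le t h1).trans_lt ht.encard_lt_top
  have h3 := Metric.packingNumber_two_mul_le_externalCoveringNumber (s / 2) A
  rw [mul_div_cancel₀ _ two_ne_zero] at h3
  exact (h3.trans_lt h2).ne

/-- The cardinality of a minimum net is bounded in terms of the volume of the manifold. -/
theorem HasConditionNumberInv.card_minNet_mul_le (hτ : HasConditionNumberInv M τ)
    (hM : IsCompactSubmanifold d M) (hd : 1 ≤ d) {V : ℝ}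
    (hV : Measure.euclideanHausdorffMeasure d M ≤ ENNReal.ofReal V) {s : ℝ≥0} (hs : 0 < s)
    (hsτ : (s : ℝ) ≤ 2 * τ) {N : Finset (EuclideanSpace ℝ (Fin D))} (hN : IsMinNet s M N) :
    N.card * ((s / 104 : ℝ) ^ d * unitBallVolume d) ≤ max V 0 := by
  have hpack := hM.1.packingNumber_ne_top hs
  obtain ⟨C, hCM, hCfin, hCsep, hCcard⟩ := Metric.exists_set_encard_eq_packingNumber hpack
  lift C to Finset (EuclideanSpace ℝ (Fin D)) using hCfin
  have hcard : N.card ≤ C.card := by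
    have h1 := Metric.coveringNumber_le_packingNumber s M
    rw [← hN.2.2, ← hCcard, Set.encard_coe_eq_coe_finsetCard] at h1
    exact_mod_cast h1
  have hs' : (0 : ℝ) < s := hs
  -- Radius `s / 52` satisfies `26 * (s / 52) = s / 2 ≤ τ`, and `s`-separation makes these balls
  -- disjoint. Halving it for the tangential ball gives `s / 104`.
  have hmeas : ∀ p ∈ C, MeasurableSet (M ∩ Metric.closedBall p (s / 52 : ℝ)) := fun p _ =>
    (hM.1.isClosed.inter Metric.isClosed_closedBall).measurableSet
  have hdisj : (C : Set (EuclideanSpace ℝ (Fin D))).PairwiseDisjoint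
      (fun p => M ∩ Metric.closedBall p (s / 52 : ℝ)) := by
    intro p hp q hq hpq
    refine Disjoint.mono Set.inter_subset_right Set.inter_subset_right
      (Metric.closedBall_disjoint_closedBall ?_)
    have h1 : ENNReal.ofReal s < ENNReal.ofReal (dist p q) := by
      rw [← edist_dist, ENNReal.ofReal_coe_nnreal]
      exact hCsep hp hq hpq
    have h2 : (s : ℝ) < dist p q := (ENNReal.ofReal_lt_ofReal_iff_of_nonneg s.2).1 h1
    linarith
  have hsum : (C.card : ℝ≥0∞) * ENNReal.ofReal ((s / 104 : ℝ) ^ d * unitBallVolume d) ≤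
      ENNReal.ofReal V := by
    calc (C.card : ℝ≥0∞) * ENNReal.ofReal ((s / 104 : ℝ) ^ d * unitBallVolume d)
        = ∑ p ∈ C, ENNReal.ofReal ((s / 104 : ℝ) ^ d * unitBallVolume d) := by
          rw [Finset.sum_const, nsmul_eq_mul]
      _ ≤ ∑ p ∈ C, Measure.euclideanHausdorffMeasure d (M ∩ Metric.closedBall p (s / 52 : ℝ)) := by
          refine Finset.sum_le_sum fun p hp => ?_
          have h1 := hτ.volume_ball_le hM (h := s / 52) (by positivity) (by linarith) (hCM hp)
          rw [volume_ball_eq hd (by positivity)] at h1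
          rwa [show (s / 104 : ℝ) = s / 52 / 2 by ring]
      _ = Measure.euclideanHausdorffMeasure d (⋃ p ∈ C, M ∩ Metric.closedBall p (s / 52 : ℝ)) :=
          (measure_biUnion_finset hdisj hmeas).symm
      _ ≤ Measure.euclideanHausdorffMeasure d M :=
          measure_mono (Set.iUnion₂_subset fun p _ => Set.inter_subset_left)
      _ ≤ _ := hV
  have hv := unitBallVolume_pos d
  calc N.card * ((s / 104 : ℝ) ^ d * unitBallVolume d)
      ≤ C.card * ((s / 104 : ℝ) ^ d * unitBallVolume d) := by gcongr
    _ ≤ max V 0 := by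
      rw [← ENNReal.ofReal_natCast, ← ENNReal.ofReal_mul (by positivity)] at hsum
      rcases le_total V 0 with hV0 | hV0
      · rw [ENNReal.ofReal_of_nonpos hV0] at hsum
        exact (ENNReal.ofReal_eq_zero.1 (nonpos_iff_eq_zero.1 hsum)).trans (le_max_right _ _)
      · exact ((ENNReal.ofReal_le_ofReal_iff hV0).1 hsum).trans (le_max_left _ _)

/-- The bound for `μ` in terms of the dimension, the volume and the scale. -/
theorem HasConditionNumberInv.muParam_le (hτ : HasConditionNumberInv M τ)
    (hM : IsCompactSubmanifold d M) (hd : 1 ≤ d) {V : ℝ}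
    (hV : Measure.euclideanHausdorffMeasure d M ≤ ENNReal.ofReal V) {s : ℝ≥0} (hs : 0 < s)
    (hsτ : (s : ℝ) ≤ 2 * τ) {N : Finset (EuclideanSpace ℝ (Fin D))} (hN : IsMinNet s M N)
    (hN0 : N.Nonempty) (n : ℕ) :
    muParam n N ≤ (1 + Real.log (max V 1) + Real.log 104) * d +
      Real.log (1 / unitBallVolume d) + Real.log n + d * Real.log (1 / (s : ℝ)) := by
  have hv := unitBallVolume_pos d
  have hs' : (0 : ℝ) < s := hs
  have hc : (0 : ℝ) < N.card := by exact_mod_cast hN0.card_pos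
  have h1 : N.card * ((s / 104 : ℝ) ^ d * unitBallVolume d) ≤ max V 1 :=
    (hτ.card_minNet_mul_le hM hd hV hs hsτ hN).trans (max_le_max le_rfl zero_le_one)
  have h2 := Real.log_le_log (by positivity) h1
  rw [Real.log_mul hc.ne' (by positivity), Real.log_mul (by positivity) hv.ne', Real.log_pow,
    Real.log_div hs'.ne' (by norm_num)] at h2
  have h3 : 0 ≤ Real.log (max V 1) := Real.log_nonneg (le_max_right _ _)
  -- Since `d ≥ 1`, the terms `1` and `log (max V 1)` fit into the multiple of `d`.
  have hd' : (1 : ℝ) ≤ d := by exact_mod_cast hd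
  rw [muParam, one_div, one_div, Real.log_inv, Real.log_inv]
  nlinarith

end Volume

/-! ### Replacing all balls about a centre by one set -/

section Cores

/-- By inner regularity it is enough to bound compact subsets `K`. The maximum of `K` belongs to the
set, and `K` lies in the half-line below it, so atoms need no separate treatment. -/
theorem measureReal_setOf_Iic_le (ν : Measure ℝ) [IsProbabilityMeasure ν] {t : ℝ} (ht : 0 ≤ t) :
    ν.real {r | ν.real (Set.Iic r) ≤ t} ≤ t := by
  have hmeas : MeasurableSet {r | ν.real (Set.Iic r) ≤ t} :=
    measurableSet_le (Monotone.measurable fun a b hab =>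
      measureReal_mono (Set.Iic_subset_Iic.2 hab)) measurable_const
  by_contra! hlt
  have hlt' : ENNReal.ofReal t < ν {r | ν.real (Set.Iic r) ≤ t} :=
    (ENNReal.ofReal_lt_iff_lt_toReal ht (measure_ne_top _ _)).2 hlt
  obtain ⟨K, hKI, hK, hKt⟩ := hmeas.exists_lt_isCompact hlt'
  have hne : K.Nonempty := by
    by_contra h
    rw [Set.not_nonempty_iff_eq_empty.1 h, measure_empty] at hKt
    exact absurd hKt (by simp)
  have hm := hKI (hK.sSup_mem hne)
  have hsub : K ⊆ Set.Iic (sSup K) := fun x hx => le_csSup hK.bddAbove hx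
  have h1 : ν K ≤ ENNReal.ofReal t := by
    rw [← ENNReal.ofReal_toReal (measure_ne_top ν K)]
    exact ENNReal.ofReal_le_ofReal ((measureReal_mono hsub).trans hm)
  exact absurd hKt h1.not_gt

theorem le_measureReal_setOf_Iio_lt (ν : Measure ℝ) [IsProbabilityMeasure ν] {t : ℝ} (ht : t ≤ 1) :
    t ≤ ν.real {r | ν.real (Set.Iio r) < t} := by
  have hmeas : MeasurableSet {r | t ≤ ν.real (Set.Iio r)} :=
    measurableSet_le measurable_const (Monotone.measurable fun a b hab =>
      measureReal_mono (Set.Iio_subset_Iio hab))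
  have hcompl : {r | ν.real (Set.Iio r) < t} = {r | t ≤ ν.real (Set.Iio r)}ᶜ := by
    ext r; simp
  rw [hcompl, probReal_compl_eq_one_sub hmeas]
  by_contra! hlt
  have hlt' : ENNReal.ofReal (1 - t) < ν {r | t ≤ ν.real (Set.Iio r)} :=
    (ENNReal.ofReal_lt_iff_lt_toReal (by linarith) (measure_ne_top _ _)).2
      (by change 1 - t < ν.real _; linarith)
  obtain ⟨K, hKI, hK, hKt⟩ := hmeas.exists_lt_isCompact hlt'
  have hne : K.Nonempty := by
    by_contra h
    rw [Set.not_nonempty_iff_eq_empty.1 h, measure_empty] at hKt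
    exact absurd hKt (by simp)
  have hm : t ≤ ν.real (Set.Iio (sInf K)) := hKI (hK.sInf_mem hne)
  have hsub : K ⊆ (Set.Iio (sInf K))ᶜ := fun x hx => by
    simpa using csInf_le hK.bddBelow hx
  have h1 : ν K ≤ ENNReal.ofReal (1 - t) := by
    rw [← ENNReal.ofReal_toReal (measure_ne_top ν K)]
    refine ENNReal.ofReal_le_ofReal ((measureReal_mono hsub).trans ?_)
    rw [probReal_compl_eq_one_sub measurableSet_Iio]
    linarith
  exact absurd hKt h1.not_gt

variable {X : Type*} [PseudoMetricSpace X] [MeasurableSpace X]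

/-- The union of the closed balls about `z` of measure at most `t`. -/
def outerCore (P : Measure X) (t : ℝ) (z : X) : Set X :=
  {y | P.real (Metric.closedBall z (dist y z)) ≤ t}

/-- The points that lie in every ball about `z` of measure at least `t`. -/
def innerCore (P : Measure X) (t : ℝ) (z : X) : Set X :=
  {y | P.real (Metric.ball z (dist y z)) < t}

section Measurability

variable {P : Measure X} {t : ℝ} [SFinite P] [OpensMeasurableSpace X] [SecondCountableTopology X]

/-- Joint measurability in centre and point is needed because the centre will itself be a random
sample point. -/
theorem measurableSet_outerCore_prod :
    MeasurableSet {q : X × X | q.2 ∈ outerCore P t q.1} := by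
  have h1 : MeasurableSet {w : (X × X) × X | dist w.2 w.1.1 ≤ dist w.1.2 w.1.1} :=
    measurableSet_le (by fun_prop) (by fun_prop)
  exact measurableSet_le (measurable_measure_prodMk_left h1).ennreal_toReal measurable_const

theorem measurableSet_innerCore_prod :
    MeasurableSet {q : X × X | q.2 ∈ innerCore P t q.1} := by
  have h1 : MeasurableSet {w : (X × X) × X | dist w.2 w.1.1 < dist w.1.2 w.1.1} :=
    measurableSet_lt (by fun_prop) (by fun_prop)
  exact measurableSet_lt (measurable_measure_prodMk_left h1).ennreal_toReal measurable_const

end Measurability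

variable {P : Measure X} [IsProbabilityMeasure P] {t : ℝ} {z : X} {B : Set X}

/-- `B` is a ball, open or closed, with centre `z`. -/
def IsBallAt (z : X) (B : Set X) : Prop :=
  ∃ r : ℝ, 0 ≤ r ∧ (B = Metric.closedBall z r ∨ B = Metric.ball z r)

theorem IsBallAt.subset_outerCore (hB : IsBallAt z B) (h : P.real B ≤ t) : B ⊆ outerCore P t z := by
  obtain ⟨r, -, rfl | rfl⟩ := hB
  · exact fun y hy => (measureReal_mono (Metric.closedBall_subset_closedBall hy)).trans h
  · exact fun y hy => (measureReal_mono (Metric.closedBall_subset_ball hy)).trans h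

theorem IsBallAt.innerCore_subset (hB : IsBallAt z B) (h : t ≤ P.real B) :
    innerCore P t z ⊆ B := by
  intro y hy
  by_contra hyB
  refine absurd hy (not_lt.2 (h.trans (measureReal_mono ?_)))
  obtain ⟨r, -, rfl | rfl⟩ := hB
  · exact Metric.closedBall_subset_ball (by simpa using hyB)
  · exact Metric.ball_subset_ball (by simpa using hyB)

variable [OpensMeasurableSpace X]

theorem measureReal_outerCore_le (ht : 0 ≤ t) : P.real (outerCore P t z) ≤ t := by
  have hm : Measurable fun y : X => dist y z := (continuous_id.dist continuous_const).measurable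
  have := Measure.isProbabilityMeasure_map (μ := P) hm.aemeasurable
  have h1 : ∀ r, (P.map fun y => dist y z).real (Set.Iic r) = P.real (Metric.closedBall z r) :=
    fun r => map_measureReal_apply hm measurableSet_Iic
  have h2 := measureReal_setOf_Iic_le (P.map fun y => dist y z) ht
  have hmeas : MeasurableSet {r | (P.map fun y => dist y z).real (Set.Iic r) ≤ t} :=
    measurableSet_le (Monotone.measurable fun a b hab =>
      measureReal_mono (Set.Iic_subset_Iic.2 hab)) measurable_const
  rw [map_measureReal_apply hm hmeas] at h2
  simp only [h1] at h2
  exact h2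

theorem le_measureReal_innerCore (ht : t ≤ 1) : t ≤ P.real (innerCore P t z) := by
  have hm : Measurable fun y : X => dist y z := (continuous_id.dist continuous_const).measurable
  have := Measure.isProbabilityMeasure_map (μ := P) hm.aemeasurable
  have h1 : ∀ r, (P.map fun y => dist y z).real (Set.Iio r) = P.real (Metric.ball z r) :=
    fun r => map_measureReal_apply hm measurableSet_Iio
  have h2 := le_measureReal_setOf_Iio_lt (P.map fun y => dist y z) ht
  have hmeas : MeasurableSet {r | (P.map fun y => dist y z).real (Set.Iio r) < t} :=
    measurableSet_lt (Monotone.measurable fun a b hab =>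
      measureReal_mono (Set.Iio_subset_Iio hab)) measurable_const
  rw [map_measureReal_apply hm hmeas] at h2
  simp only [h1] at h2
  exact h2

end Cores

/-! ### Chernoff bounds and conditioning on one entry -/

section Chernoff

variable {X : Type*} {m : ℕ} {A : Set X}

/-- The number of entries of `x` that lie in `A`. -/
noncomputable def hits (A : Set X) (x : Fin m → X) : ℝ := ∑ i, A.indicator (fun _ => (1 : ℝ)) (x i)

theorem hits_mono {A B : Set X} (h : A ⊆ B) (x : Fin m → X) : hits A x ≤ hits B x :=
  Finset.sum_le_sum fun _ _ => Set.indicator_le_indicator_of_subset h (fun _ => zero_le_one) _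

theorem hits_nonneg (A : Set X) (x : Fin m → X) : 0 ≤ hits A x :=
  Finset.sum_nonneg fun _ _ => Set.indicator_nonneg (fun _ _ => zero_le_one) _

theorem hits_succAbove (A : Set X) (x : Fin (m + 1) → X) (i : Fin (m + 1)) :
    hits A x = A.indicator (fun _ => (1 : ℝ)) (x i) + hits A (fun j => x (i.succAbove j)) :=
  Fin.sum_univ_succAbove _ i

variable [MeasurableSpace X]

theorem measurable_hits (hA : MeasurableSet A) : Measurable (hits A : (Fin m → X) → ℝ) :=
  Finset.measurable_sum _ fun i _ => (measurable_const.indicator hA).comp (measurable_pi_apply i)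

theorem measurable_eval_prod_succAbove (i : Fin (m + 1)) :
    Measurable fun x : Fin (m + 1) → X => (x i, fun j => x (i.succAbove j)) :=
  (measurable_pi_apply i).prodMk (measurable_pi_lambda _ fun _ => measurable_pi_apply _)

theorem measurable_hits_prod {C : X → Set X} (hC : MeasurableSet {q : X × X | q.2 ∈ C q.1}) :
    Measurable fun q : X × (Fin m → X) => hits (C q.1) q.2 := by
  have h1 : (fun q : X × (Fin m → X) => hits (C q.1) q.2) = fun q => ∑ i,
      {q : X × X | q.2 ∈ C q.1}.indicator (fun _ => (1 : ℝ)) (q.1, q.2 i) := rfl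
  rw [h1]
  exact Finset.measurable_sum _ fun i _ => (measurable_const.indicator hC).comp
    (measurable_fst.prodMk ((measurable_pi_apply i).comp measurable_snd))

variable {P : Measure X} [IsProbabilityMeasure P]

theorem integrable_exp_mul_hits (hA : MeasurableSet A) (l : ℝ) :
    Integrable (fun x : Fin m → X => Real.exp (l * hits A x)) (Measure.pi fun _ => P) := by
  refine Integrable.of_bound (C := Real.exp (|l| * m))
    ((measurable_hits hA).const_mul l).exp.aestronglyMeasurable (ae_of_all _ fun x => ?_)
  rw [Real.norm_of_nonneg (Real.exp_pos _).le, Real.exp_le_exp]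
  have h1 : hits A x ≤ m := by
    calc hits A x ≤ ∑ i : Fin m, (1 : ℝ) :=
          Finset.sum_le_sum fun _ _ => Set.indicator_le_self' (fun _ _ => zero_le_one) _
      _ = m := by simp
  exact mul_le_mul (le_abs_self l) h1 (hits_nonneg A x) (abs_nonneg l)

/-- Independence factors the moment generating function, and `1 + x ≤ exp x` gives the Poisson form.
-/
theorem mgf_hits_le (hA : MeasurableSet A) (l : ℝ) :
    ProbabilityTheory.mgf (hits A : (Fin m → X) → ℝ) (Measure.pi fun _ => P) l ≤
      Real.exp (m * P.real A * (Real.exp l - 1)) := by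
  have h1 : ∀ x : Fin m → X, Real.exp (l * hits A x) =
      ∏ i, (1 + A.indicator (fun _ => Real.exp l - 1) (x i)) := by
    intro x
    rw [hits, Finset.mul_sum, Real.exp_sum]
    refine Finset.prod_congr rfl fun i _ => ?_
    by_cases hx : x i ∈ A <;> simp [hx]
  have h2 : ∫ x, (1 + A.indicator (fun _ => Real.exp l - 1) x) ∂P =
      1 + P.real A * (Real.exp l - 1) := by
    rw [integral_add (integrable_const _) ((integrable_const _).indicator hA),
      integral_indicator_const _ hA]
    simp
  have h3 : 0 ≤ 1 + P.real A * (Real.exp l - 1) := by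
    nlinarith [Real.exp_pos l, measureReal_nonneg (μ := P) (s := A),
      measureReal_le_one (μ := P) (s := A)]
  rw [ProbabilityTheory.mgf]
  simp only [h1]
  rw [integral_fintype_prod_eq_pow (fun x => 1 + A.indicator (fun _ => Real.exp l - 1) x), h2,
    Fintype.card_fin, mul_assoc, Real.exp_nat_mul]
  gcongr
  rw [add_comm]
  exact Real.add_one_le_exp _

theorem measureReal_le_hits_le (hA : MeasurableSet A) {l : ℝ} (hl : 0 ≤ l) (a : ℝ) :
    (Measure.pi fun _ : Fin m => P).real {x | a ≤ hits A x} ≤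
      Real.exp (-l * a + m * P.real A * (Real.exp l - 1)) := by
  rw [Real.exp_add]
  refine (ProbabilityTheory.measure_ge_le_exp_mul_mgf a hl (integrable_exp_mul_hits hA l)).trans ?_
  gcongr
  exact mgf_hits_le hA l

theorem measureReal_hits_le_le (hA : MeasurableSet A) {l : ℝ} (hl : l ≤ 0) (a : ℝ) :
    (Measure.pi fun _ : Fin m => P).real {x | hits A x ≤ a} ≤
      Real.exp (-l * a + m * P.real A * (Real.exp l - 1)) := by
  rw [Real.exp_add]
  refine (ProbabilityTheory.measure_le_le_exp_mul_mgf a hl (integrable_exp_mul_hits hA l)).trans ?_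
  gcongr
  exact mgf_hits_le hA l

variable {k μ c : ℝ}

/-- A common bound for the tails that occur below. -/
noncomputable def tailBound (μ c : ℝ) : ℝ := Real.exp (-((c - 2) * μ / 4))

/-- The witness `√(μ / k) / 2` makes both the gain `l √(k μ)` and the quadratic loss `l² k` fixed
multiples of `μ`. -/
theorem exists_chernoff_scale (hμ : 1 ≤ μ) (hk : μ ≤ k) :
    ∃ l : ℝ, 0 < l ∧ l ≤ 1 / 2 ∧ l * Real.sqrt (k * μ) = μ / 2 ∧ l ^ 2 * k = μ / 4 := by
  have hk0 : 0 < k := by linarith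
  have hμ0 : 0 < μ := by linarith
  refine ⟨Real.sqrt (μ / k) / 2, by positivity, ?_, ?_, ?_⟩
  · have : Real.sqrt (μ / k) ≤ 1 := Real.sqrt_le_one.2 ((div_le_one hk0).2 hk)
    linarith
  · rw [div_mul_eq_mul_div, ← Real.sqrt_mul (by positivity),
      show μ / k * (k * μ) = μ ^ 2 by field_simp, Real.sqrt_sq hμ0.le]
  · rw [div_pow, Real.sq_sqrt (by positivity)]
    field_simp
    norm_num

theorem one_le_sqrt_mul (hμ : 1 ≤ μ) (hk : μ ≤ k) : 1 ≤ Real.sqrt (k * μ) :=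
  Real.one_le_sqrt.2 (by nlinarith)

/-- The exponent is at most `l² k - (c - 1) l √(kμ) (1 - l) ≤ μ / 4 - (c - 1) μ / 4`, which is the
one in `tailBound`. The slack `c - 1` leaves room for dropping an entry from the sample. -/
theorem measureReal_hits_le_le_tailBound (hA : MeasurableSet A) (hμ : 1 ≤ μ) (hk : μ ≤ k)
    (hc : 1 ≤ c) (h : k + (c - 1) * Real.sqrt (k * μ) ≤ m * P.real A) :
    (Measure.pi fun _ : Fin m => P).real {x | hits A x ≤ k} ≤ tailBound μ c := by
  obtain ⟨l, hl0, hl1, hl2, hl3⟩ := exists_chernoff_scale hμ hk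
  refine (measureReal_hits_le_le hA (neg_nonpos.2 hl0.le) k).trans (Real.exp_le_exp.2 ?_)
  have h1 : Real.exp (-l) - 1 ≤ -(l - l ^ 2) := by
    have := (abs_le.1 (Real.abs_exp_sub_one_sub_id_le (x := -l)
      (by rw [abs_neg, abs_of_pos hl0]; linarith))).2
    linarith [neg_sq l]
  have h2 : 0 ≤ l - l ^ 2 := by nlinarith
  set σ := Real.sqrt (k * μ)
  have h3 : m * P.real A * (Real.exp (-l) - 1) ≤ -((k + (c - 1) * σ) * (l - l ^ 2)) := by
    have h4 : 0 ≤ m * P.real A := by positivity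
    calc m * P.real A * (Real.exp (-l) - 1) ≤ m * P.real A * (-(l - l ^ 2)) := by gcongr
      _ = -(m * P.real A * (l - l ^ 2)) := by ring
      _ ≤ _ := by gcongr
  have h5 : (k + (c - 1) * σ) * (l - l ^ 2) =
      l * k - l ^ 2 * k + (c - 1) * (l * σ) * (1 - l) := by ring
  have h6 : (c - 1) * (μ / 2) * (1 / 2) ≤ (c - 1) * (μ / 2) * (1 - l) :=
    mul_le_mul_of_nonneg_left (by linarith)
      (mul_nonneg (by linarith) (by linarith))
  rw [h5, hl2, hl3] at h3
  linarith

/-- The threshold `k - 1` leaves room for a sample centre to count itself. It costs `l ≤ 1 / 2` in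
the exponent, absorbed by `1 ≤ μ`. -/
theorem measureReal_le_hits_le_tailBound (hA : MeasurableSet A) (hμ : 1 ≤ μ) (hk : μ ≤ k)
    (hc : 1 ≤ c) (h : m * P.real A ≤ k - c * Real.sqrt (k * μ)) :
    (Measure.pi fun _ : Fin m => P).real {x | k - 1 ≤ hits A x} ≤ tailBound μ c := by
  obtain ⟨l, hl0, hl1, hl2, hl3⟩ := exists_chernoff_scale hμ hk
  refine (measureReal_le_hits_le hA hl0.le (k - 1)).trans (Real.exp_le_exp.2 ?_)
  have h1 : Real.exp l - 1 ≤ l + l ^ 2 := by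
    have := (abs_le.1 (Real.abs_exp_sub_one_sub_id_le (x := l)
      (by rw [abs_of_pos hl0]; linarith))).2
    linarith
  set σ := Real.sqrt (k * μ)
  have h3 : m * P.real A * (Real.exp l - 1) ≤ (k - c * σ) * (l + l ^ 2) := by
    have h4 : 0 ≤ m * P.real A := by positivity
    calc m * P.real A * (Real.exp l - 1) ≤ m * P.real A * (l + l ^ 2) := by gcongr
      _ ≤ _ := by gcongr
  have h5 : (k - c * σ) * (l + l ^ 2) =
      l * k + l ^ 2 * k - c * (l * σ) * (1 + l) := by ring
  have h6 : c * (μ / 2) * 1 ≤ c * (μ / 2) * (1 + l) :=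
    mul_le_mul_of_nonneg_left (by linarith)
      (mul_nonneg (by linarith) (by linarith))
  rw [h5, hl2, hl3] at h3
  nlinarith

theorem measureReal_hits_le_zero_le_tailBound (hA : MeasurableSet A) (hμ : 1 ≤ μ)
    (h : c * μ ≤ m * P.real A) :
    (Measure.pi fun _ : Fin m => P).real {x | hits A x ≤ 0} ≤ tailBound μ c := by
  refine (measureReal_hits_le_le hA (l := -1) (by norm_num) 0).trans (Real.exp_le_exp.2 ?_)
  have h1 : Real.exp (-1) ≤ 1 / 2 := by
    rw [Real.exp_neg, one_div]
    exact inv_anti₀ two_pos (by linarith [Real.add_one_le_exp 1])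
  have h2 : 0 ≤ m * P.real A := by positivity
  have h3 : m * P.real A * (Real.exp (-1) - 1) ≤ m * P.real A * (-(1 / 2)) := by
    gcongr; linarith
  nlinarith

/-- Conditioning on one entry of an i.i.d. sample. -/
theorem measureReal_pi_succ_le {F : Set (X × (Fin m → X))} (hF : MeasurableSet F) {β : ℝ}
    (h : ∀ z, (Measure.pi fun _ : Fin m => P).real {y | (z, y) ∈ F} ≤ β) (i : Fin (m + 1)) :
    (Measure.pi fun _ : Fin (m + 1) => P).real {x | (x i, fun j => x (i.succAbove j)) ∈ F} ≤ β := by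
  have hmp := measurePreserving_piFinSuccAbove (fun _ : Fin (m + 1) => P) i
  have h1 : (Measure.pi fun _ : Fin (m + 1) => P).real
      {x | (x i, fun j => x (i.succAbove j)) ∈ F} =
      (P.prod (Measure.pi fun _ : Fin m => P)).real F :=
    hmp.measureReal_preimage hF.nullMeasurableSet
  have : Nonempty X := (Measure.nonempty_of_neZero P)
  have hβ : 0 ≤ β := measureReal_nonneg.trans (h (Classical.arbitrary X))
  rw [h1]
  refine ENNReal.toReal_le_of_le_ofReal hβ ?_
  rw [Measure.prod_apply hF]
  calc ∫⁻ z, (Measure.pi fun _ : Fin m => P) (Prod.mk z ⁻¹' F) ∂P ≤ ∫⁻ _, ENNReal.ofReal β ∂P := by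
        refine lintegral_mono fun z => ?_
        rw [← ENNReal.ofReal_toReal (measure_ne_top _ (Prod.mk z ⁻¹' F))]
        exact ENNReal.ofReal_le_ofReal (h z)
    _ = ENNReal.ofReal β := by simp

end Chernoff

/-! ### Bad events for each centre and the union bound -/

section Estimates

variable {X : Type*} [PseudoMetricSpace X] [MeasurableSpace X] {P : Measure X} {n m : ℕ}
  {k μ c : ℝ}

/-- The three comparisons between the measure of `B` and its share of the sample `x`. -/
def BallEstimates (P : Measure X) (k μ c : ℝ) (x : Fin n → X) (B : Set X) : Prop :=
  (c * μ / n ≤ P.real B → 0 < hits B x / n) ∧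
  (k / n + c / n * Real.sqrt (k * μ) ≤ P.real B → k / n ≤ hits B x / n) ∧
  (P.real B ≤ k / n - c / n * Real.sqrt (k * μ) → hits B x / n < k / n)

/-- Used with `q` a range condition `t ≤ 1` or `0 ≤ t`: outside that range the premise on `P.real B`
cannot hold, so no bad event is needed. -/
theorem measureReal_setOf_and_le {Ω : Type*} [MeasurableSpace Ω] {ν : Measure Ω} {p : Ω → Prop}
    {q : Prop} {β : ℝ} (hβ : 0 ≤ β) (h : q → ν.real {x | p x} ≤ β) :
    ν.real {x | p x ∧ q} ≤ β := by
  by_cases hq : q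
  · simpa [hq] using h hq
  · simpa [hq] using hβ

theorem tailBound_nonneg (μ c : ℝ) : 0 ≤ tailBound μ c := (Real.exp_pos _).le

variable [OpensMeasurableSpace X] [SecondCountableTopology X] [IsProbabilityMeasure P]

/-- With high probability the estimates hold for all balls about a fixed centre. -/
theorem exists_bad_of_center (hn : 1 ≤ n) (hμ : 1 ≤ μ) (hk : μ ≤ k) (hc : 1 ≤ c) (z : X) :
    ∃ S : Set (Fin n → X), MeasurableSet S ∧
      (Measure.pi fun _ : Fin n => P).real S ≤ 3 * tailBound μ c ∧
      ∀ x ∉ S, ∀ B, IsBallAt z B → BallEstimates P k μ c x B := by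
  have hn0 : (0 : ℝ) < n := by exact_mod_cast hn
  have hin : ∀ t, MeasurableSet (innerCore P t z) := fun t =>
    measurable_prodMk_left (x := z) measurableSet_innerCore_prod
  have hout : ∀ t, MeasurableSet (outerCore P t z) := fun t =>
    measurable_prodMk_left (x := z) measurableSet_outerCore_prod
  set σ := Real.sqrt (k * μ) with hσ
  have hσ1 : 1 ≤ σ := one_le_sqrt_mul hμ hk
  set t₁ := c * μ / n with ht₁
  set t₂ := k / n + c / n * σ with ht₂
  set t₃ := k / n - c / n * σ with ht₃
  have hβ := tailBound_nonneg μ c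
  have h1 : (Measure.pi fun _ : Fin n => P).real
      {x | hits (innerCore P t₁ z) x ≤ 0 ∧ t₁ ≤ 1} ≤ tailBound μ c := by
    refine measureReal_setOf_and_le hβ fun ht => ?_
    refine measureReal_hits_le_zero_le_tailBound (hin _) hμ ?_
    calc c * μ = n * t₁ := by rw [ht₁]; field_simp
      _ ≤ _ := by gcongr; exact le_measureReal_innerCore ht
  have h2 : (Measure.pi fun _ : Fin n => P).real
      {x | hits (innerCore P t₂ z) x ≤ k ∧ t₂ ≤ 1} ≤ tailBound μ c := by
    refine measureReal_setOf_and_le hβ fun ht => ?_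
    refine measureReal_hits_le_le_tailBound (hin _) hμ hk hc ?_
    calc k + (c - 1) * σ ≤ k + c * σ := by nlinarith
      _ = n * t₂ := by rw [ht₂]; field_simp
      _ ≤ _ := by gcongr; exact le_measureReal_innerCore ht
  have h3 : (Measure.pi fun _ : Fin n => P).real
      {x | k - 1 ≤ hits (outerCore P t₃ z) x ∧ 0 ≤ t₃} ≤ tailBound μ c := by
    refine measureReal_setOf_and_le hβ fun ht => ?_
    refine measureReal_le_hits_le_tailBound (hout _) hμ hk hc ?_
    calc n * P.real (outerCore P t₃ z) ≤ n * t₃ := by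
          gcongr; exact measureReal_outerCore_le ht
      _ = k - c * σ := by
          rw [ht₃, mul_sub, ← mul_assoc, mul_div_cancel₀ _ hn0.ne', mul_div_cancel₀ _ hn0.ne']
  refine ⟨{x | hits (innerCore P t₁ z) x ≤ 0 ∧ t₁ ≤ 1} ∪
    {x | hits (innerCore P t₂ z) x ≤ k ∧ t₂ ≤ 1} ∪
    {x | k - 1 ≤ hits (outerCore P t₃ z) x ∧ 0 ≤ t₃},
    (((measurableSet_le (measurable_hits (hin t₁)) measurable_const).inter
    (MeasurableSet.const _)).union ((measurableSet_le (measurable_hits (hin t₂))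
    measurable_const).inter (MeasurableSet.const _))).union ((measurableSet_le measurable_const
    (measurable_hits (hout t₃))).inter (MeasurableSet.const _)), ?_, ?_⟩
  · calc _ ≤ tailBound μ c + tailBound μ c + tailBound μ c :=
          (measureReal_union_le _ _).trans (add_le_add ((measureReal_union_le _ _).trans
            (add_le_add h1 h2)) h3)
      _ = _ := by ring
  · intro x hx B hB
    have hx1 : ¬ (hits (innerCore P t₁ z) x ≤ 0 ∧ t₁ ≤ 1) := fun h => hx (Or.inl (Or.inl h))
    have hx2 : ¬ (hits (innerCore P t₂ z) x ≤ k ∧ t₂ ≤ 1) := fun h => hx (Or.inl (Or.inr h))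
    have hx3 : ¬ (k - 1 ≤ hits (outerCore P t₃ z) x ∧ 0 ≤ t₃) := fun h => hx (Or.inr h)
    refine ⟨fun h => ?_, fun h => ?_, fun h => ?_⟩
    · have h4 := lt_of_not_ge fun h' => hx1 ⟨h', h.trans measureReal_le_one⟩
      exact div_pos (h4.trans_le (hits_mono (hB.innerCore_subset h) x)) hn0
    · have h4 := lt_of_not_ge fun h' => hx2 ⟨h', h.trans measureReal_le_one⟩
      have h5 := hits_mono (hB.innerCore_subset h) x
      gcongr
      linarith
    · have h4 := lt_of_not_ge fun h' => hx3 ⟨h', measureReal_nonneg.trans h⟩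
      have h5 := hits_mono (hB.subset_outerCore h) x
      gcongr
      linarith

theorem measurableSet_hits_innerCore_le (t a : ℝ) :
    MeasurableSet {q : X × (Fin m → X) | hits (innerCore P t q.1) q.2 ≤ a} :=
  measurableSet_le (measurable_hits_prod measurableSet_innerCore_prod) measurable_const

theorem measurableSet_le_hits_outerCore (t a : ℝ) :
    MeasurableSet {q : X × (Fin m → X) | a ≤ hits (outerCore P t q.1) q.2} :=
  measurableSet_le measurable_const (measurable_hits_prod measurableSet_outerCore_prod)

/-- Only `m` of the `m + 1` entries are counted. The expected count falls by at most `1 ≤ √(k μ)`,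
which turns `c` into `c - 1`. -/
theorem measureReal_hits_innerCore_sample_le (hμ : 1 ≤ μ) (hk : μ ≤ k) (hc : 1 ≤ c)
    (i : Fin (m + 1)) {t : ℝ} (ht : (m + 1) * t = k + c * Real.sqrt (k * μ)) (ht1 : t ≤ 1) :
    (Measure.pi fun _ : Fin (m + 1) => P).real
      {x | hits (innerCore P t (x i)) (fun j => x (i.succAbove j)) ≤ k} ≤ tailBound μ c := by
  refine measureReal_pi_succ_le (measurableSet_hits_innerCore_le t k) (fun z => ?_) i
  refine measureReal_hits_le_le_tailBound
    (A := innerCore P t z) (measurable_prodMk_left (x := z) measurableSet_innerCore_prod) hμ hk hc ?_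
  have hσ1 := one_le_sqrt_mul hμ hk
  have h5 := le_measureReal_innerCore (P := P) (z := z) ht1
  have h6 : P.real (innerCore P t z) ≤ 1 := measureReal_le_one
  have h7 : ((m : ℝ) + 1) * t ≤ (m + 1) * P.real (innerCore P t z) := by gcongr
  linarith

theorem measureReal_le_hits_outerCore_sample (hμ : 1 ≤ μ) (hk : μ ≤ k) (hc : 1 ≤ c)
    (i : Fin (m + 1)) {t : ℝ} (ht : (m + 1) * t = k - c * Real.sqrt (k * μ)) (ht0 : 0 ≤ t) :
    (Measure.pi fun _ : Fin (m + 1) => P).real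
      {x | k - 1 ≤ hits (outerCore P t (x i)) (fun j => x (i.succAbove j))} ≤ tailBound μ c := by
  refine measureReal_pi_succ_le (measurableSet_le_hits_outerCore t (k - 1)) (fun z => ?_) i
  refine measureReal_le_hits_le_tailBound
    (A := outerCore P t z) (measurable_prodMk_left (x := z) measurableSet_outerCore_prod) hμ hk hc ?_
  rw [← ht]
  have h5 := measureReal_outerCore_le (P := P) (z := z) ht0
  have h6 : (m : ℝ) * P.real (outerCore P t z) ≤ m * t := by gcongr
  linarith

/-- With high probability the estimates hold for all balls about a given sample point. -/
theorem exists_bad_of_sample (hμ : 1 ≤ μ) (hk : μ ≤ k) (hc : 1 ≤ c) (i : Fin (m + 1)) :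
    ∃ S : Set (Fin (m + 1) → X), MeasurableSet S ∧
      (Measure.pi fun _ : Fin (m + 1) => P).real S ≤ 3 * tailBound μ c ∧
      ∀ x ∉ S, ∀ B, IsBallAt (x i) B → BallEstimates P k μ c x B := by
  obtain ⟨r, hr⟩ : ∃ r : ℝ, r = (m + 1 : ℕ) := ⟨_, rfl⟩
  have hr0 : 0 < r := by rw [hr]; positivity
  have hr1 : (m : ℝ) + 1 = r := by rw [hr]; push_cast; rfl
  obtain ⟨t₂, ht₂⟩ : ∃ t, t = k / r + c / r * Real.sqrt (k * μ) := ⟨_, rfl⟩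
  obtain ⟨t₃, ht₃⟩ : ∃ t, t = k / r - c / r * Real.sqrt (k * μ) := ⟨_, rfl⟩
  have hm2 : MeasurableSet {x : Fin (m + 1) → X |
      hits (innerCore P t₂ (x i)) (fun j => x (i.succAbove j)) ≤ k ∧ t₂ ≤ 1} :=
    MeasurableSet.inter (measurable_eval_prod_succAbove i
      (measurableSet_hits_innerCore_le (P := P) t₂ k)) (MeasurableSet.const _)
  have hm3 : MeasurableSet {x : Fin (m + 1) → X |
      k - 1 ≤ hits (outerCore P t₃ (x i)) (fun j => x (i.succAbove j)) ∧ 0 ≤ t₃} :=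
    MeasurableSet.inter (measurable_eval_prod_succAbove i
      (measurableSet_le_hits_outerCore (P := P) t₃ (k - 1))) (MeasurableSet.const _)
  have h2 := measureReal_setOf_and_le (tailBound_nonneg μ c) fun ht =>
    measureReal_hits_innerCore_sample_le (P := P) hμ hk hc i (t := t₂)
      (by rw [hr1, ht₂]; field_simp) ht
  have h3 := measureReal_setOf_and_le (tailBound_nonneg μ c) fun ht =>
    measureReal_le_hits_outerCore_sample (P := P) hμ hk hc i (t := t₃)
      (by rw [hr1, ht₃]; field_simp) ht
  refine ⟨_, hm2.union hm3, (measureReal_union_le _ _).trans ((add_le_add h2 h3).trans ?_), ?_⟩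
  · linarith [tailBound_nonneg μ c]
  intro x hx B hB
  obtain ⟨y, hy⟩ : ∃ y : Fin m → X, y = fun j => x (i.succAbove j) := ⟨_, rfl⟩
  have hx2 : ¬ (hits (innerCore P t₂ (x i)) y ≤ k ∧ t₂ ≤ 1) :=
    fun h => hx (Or.inl (by rwa [hy] at h))
  have hx3 : ¬ (k - 1 ≤ hits (outerCore P t₃ (x i)) y ∧ 0 ≤ t₃) :=
    fun h => hx (Or.inr (by rwa [hy] at h))
  have hsucc := hits_succAbove B x i
  rw [← hy] at hsucc
  rw [BallEstimates, ← hr, ← ht₂, ← ht₃]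
  refine ⟨fun h => ?_, fun h => ?_, fun h => ?_⟩
  · have hpos : 0 < P.real B :=
      lt_of_lt_of_le (div_pos (mul_pos (by linarith) (by linarith)) hr0) h
    -- The centre is itself a hit, so the first estimate needs no bad event; positive measure
    -- excludes the empty open ball of radius zero.
    have hxB : x i ∈ B := by
      obtain ⟨ρ, hρ, rfl | rfl⟩ := hB
      · exact Metric.mem_closedBall_self hρ
      · refine Metric.mem_ball_self (lt_of_le_of_ne hρ ?_)
        rintro rfl
        simp at hpos
    rw [Set.indicator_of_mem hxB] at hsucc
    have := hits_nonneg B y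
    exact div_pos (by linarith) hr0
  · have h4 := lt_of_not_ge fun h' => hx2 ⟨h', h.trans measureReal_le_one⟩
    have h5 := hits_mono (hB.innerCore_subset h) y
    have h6 : 0 ≤ B.indicator (fun _ => (1 : ℝ)) (x i) :=
      Set.indicator_nonneg (fun _ _ => zero_le_one) _
    gcongr
    linarith
  · have h4 := lt_of_not_ge fun h' => hx3 ⟨h', measureReal_nonneg.trans h⟩
    have h5 := hits_mono (hB.subset_outerCore h) y
    have h6 : B.indicator (fun _ => (1 : ℝ)) (x i) ≤ 1 :=
      Set.indicator_le_self' (fun _ _ => zero_le_one) _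
    gcongr
    linarith

/-- The union bound over all net points and sample points. -/
theorem exists_good_event (hn : 1 ≤ n) (hμ : 1 ≤ μ) (hk : μ ≤ k) (hc : 1 ≤ c) (N : Finset X) :
    ∃ E : Set (Fin n → X), MeasurableSet E ∧
      1 - (N.card + n) * (3 * tailBound μ c) ≤ (Measure.pi fun _ : Fin n => P).real E ∧
      ∀ x ∈ E, ∀ z, (z ∈ N ∨ z ∈ Set.range x) → ∀ B, IsBallAt z B → BallEstimates P k μ c x B := by
  obtain ⟨m, rfl⟩ : ∃ m, n = m + 1 := ⟨n - 1, by omega⟩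
  choose S hSm hSβ hS using fun z : X => exists_bad_of_center (P := P) hn hμ hk hc z
  choose T hTm hTβ hT using fun i : Fin (m + 1) => exists_bad_of_sample (P := P) hμ hk hc i
  have hmeas : MeasurableSet ((⋃ z ∈ N, S z) ∪ ⋃ i ∈ Finset.univ, T i) :=
    (N.measurableSet_biUnion fun z _ => hSm z).union
      (Finset.univ.measurableSet_biUnion fun i _ => hTm i)
  refine ⟨((⋃ z ∈ N, S z) ∪ ⋃ i ∈ Finset.univ, T i)ᶜ, hmeas.compl, ?_, ?_⟩
  · rw [probReal_compl_eq_one_sub hmeas]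
    have h1 : (Measure.pi fun _ : Fin (m + 1) => P).real (⋃ z ∈ N, S z) ≤
        N.card * (3 * tailBound μ c) := by
      refine (measureReal_biUnion_finset_le _ _).trans ?_
      rw [← nsmul_eq_mul]
      exact Finset.sum_le_card_nsmul _ _ _ fun z _ => hSβ z
    have h2 : (Measure.pi fun _ : Fin (m + 1) => P).real (⋃ i ∈ Finset.univ, T i) ≤
        (m + 1 : ℕ) * (3 * tailBound μ c) := by
      refine (measureReal_biUnion_finset_le _ _).trans ?_
      rw [← nsmul_eq_mul]
      refine (Finset.sum_le_card_nsmul _ _ _ fun i _ => hTβ i).trans_eq ?_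
      simp
    have h3 := measureReal_union_le (μ := Measure.pi fun _ : Fin (m + 1) => P) (⋃ z ∈ N, S z)
      (⋃ i ∈ Finset.univ, T i)
    linarith
  · rintro x hx z (hz | ⟨i, rfl⟩) B hB
    · exact hS z x (fun h => hx (Or.inl (Set.mem_biUnion hz h))) B hB
    · exact hT i x (fun h => hx (Or.inr (Set.mem_biUnion (Finset.mem_coe.2 (Finset.mem_univ i)) h)))
        B hB

theorem half_le_log_two_div {δ : ℝ} (hδ : 0 < δ) (hδ1 : δ ≤ 1) : 1 / 2 ≤ Real.log (2 / δ) := by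
  have h1 : Real.log 2 ≤ Real.log (2 / δ) :=
    Real.log_le_log two_pos (by rw [le_div_iff₀ hδ]; linarith)
  linarith [Real.log_two_gt_d9]

/-- Since `a, b ≥ 1`, the number of centres is at most `2ab = 2 exp (μ - 1)`. The tail exponent is
`-16 L μ + μ / 2` with `L ≥ 1 / 2` and `μ ≥ 1`, enough to cancel this and leave `exp (-5 - L) = exp
(-5) δ / 2`. -/
theorem card_mul_tailBound_lt {a b δ : ℝ} (ha : 1 ≤ a) (hb : 1 ≤ b) (hδ : 0 < δ) (hδ1 : δ ≤ 1) :
    (a + b) * (3 * tailBound (1 + Real.log b + Real.log a) (64 * Real.log (2 / δ))) < δ := by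
  have hL := half_le_log_two_div hδ hδ1
  have hla := Real.log_nonneg ha
  have hlb := Real.log_nonneg hb
  set L := Real.log (2 / δ) with hLdef
  set μ := 1 + Real.log b + Real.log a with hμdef
  have hab : a * b = Real.exp (μ - 1) := by
    rw [hμdef, show 1 + Real.log b + Real.log a - 1 = Real.log a + Real.log b by ring, Real.exp_add,
      Real.exp_log (by linarith), Real.exp_log (by linarith)]
  have hδe : δ / 2 = Real.exp (-L) := by
    rw [Real.exp_neg, hLdef, Real.exp_log (by positivity), inv_div]
  have hμ1 : 1 ≤ μ := by linarith
  have hexp : μ - 1 + -((64 * L - 2) * μ / 4) ≤ -5 + -L := by nlinarith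
  have h6 : 6 * Real.exp (-5) < 2 := by
    have h5 : (6 : ℝ) ≤ Real.exp 5 := by linarith [Real.add_one_le_exp 5]
    rw [Real.exp_neg]
    have : 6 * (Real.exp 5)⁻¹ ≤ 1 := by
      rw [← div_eq_mul_inv]; exact (div_le_one (Real.exp_pos _)).2 h5
    linarith
  have hsum : a + b ≤ 2 * (a * b) := by nlinarith
  calc (a + b) * (3 * tailBound μ (64 * L)) ≤ 2 * (a * b) * (3 * tailBound μ (64 * L)) :=
        mul_le_mul_of_nonneg_right hsum (mul_nonneg (by norm_num) (tailBound_nonneg _ _))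
    _ = 6 * Real.exp (μ - 1 + -((64 * L - 2) * μ / 4)) := by
        rw [hab, tailBound, Real.exp_add]; ring
    _ ≤ 6 * Real.exp (-5 + -L) := by gcongr
    _ = 6 * Real.exp (-5) * (δ / 2) := by rw [Real.exp_add, hδe]; ring
    _ < 2 * (δ / 2) := by gcongr
    _ = δ := by ring

end Estimates

end ManifoldBalls

/-! ### Assembly of the two bounds -/

theorem lemma3p1 :
    ∃ C₀ : ℝ, 0 < C₀ ∧ ∀ V : ℝ, ∃ C : ℝ, 0 < C ∧
      ∀ (d D : ℕ), 1 ≤ d → d < D →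
      ∀ (M : Set (EuclideanSpace ℝ (Fin D))) (τ : ℝ),
        ManifoldBalls.IsCompactSubmanifold d M →
        ManifoldBalls.HasConditionNumberInv M τ →
        Measure.euclideanHausdorffMeasure d M ≤ ENNReal.ofReal V →
      ∀ (P : Measure (EuclideanSpace ℝ (Fin D))), IsProbabilityMeasure P → P Mᶜ = 0 →
      ∀ (s : ℝ≥0), 0 < s →
      ∀ (N : Finset (EuclideanSpace ℝ (Fin D))), ManifoldBalls.IsMinNet s M N →
      ∀ n : ℕ, 1 ≤ n →
        ((s : ℝ) ≤ 2 * τ →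
          ManifoldBalls.muParam n N ≤
            C * d + Real.log (1 / ManifoldBalls.unitBallVolume d) + Real.log n
              + d * Real.log (1 / (s : ℝ))) ∧
        ∀ k : ℝ, ManifoldBalls.muParam n N ≤ k →
        ∀ δ : ℝ, 0 < δ →
          ∃ E : Set (Fin n → EuclideanSpace ℝ (Fin D)), MeasurableSet E ∧
            1 - δ < (Measure.pi (fun _ : Fin n => P)).real E ∧
            ∀ x ∈ E, ManifoldBalls.UniformConvergence P N x k (ManifoldBalls.muParam n N)
              (ManifoldBalls.confConst C₀ δ) := by
  -- `C₀ = 32` makes the confidence constant `64 log (2 / δ)`, as in the union bound. The summand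
  -- `log 104` comes from the volume radius `s / 104`.
  refine ⟨32, by norm_num, fun V => ⟨1 + Real.log (max V 1) + Real.log 104, ?_, ?_⟩⟩
  · have h1 : 0 ≤ Real.log (max V 1) := Real.log_nonneg (le_max_right _ _)
    have h2 : 0 ≤ Real.log 104 := Real.log_nonneg (by norm_num)
    linarith
  intro d D hd _ M τ hM hτ hV P hP hPM s hs N hN n hn
  have hN0 : N.Nonempty := by
    have hMne : M.Nonempty := by
      by_contra h
      rw [Set.not_nonempty_iff_eq_empty.1 h, Set.compl_empty, measure_univ] at hPM
      exact one_ne_zero hPM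
    obtain ⟨x, hx⟩ := hMne
    obtain ⟨y, hy, -⟩ := hN.2.1 hx
    exact ⟨y, hy⟩
  refine ⟨fun hsτ => hτ.muParam_le hM hd hV hs hsτ hN hN0 n, fun k hk δ hδ => ?_⟩
  -- For `δ > 1` the probability bound is negative and the empty event suffices; the lower bound on
  -- `log (2 / δ)` needs `δ ≤ 1`.
  rcases lt_or_ge 1 δ with hδ1 | hδ1
  · exact ⟨∅, MeasurableSet.empty, by simpa using hδ1, fun x hx => hx.elim⟩
  have hcard : (1 : ℝ) ≤ N.card := by exact_mod_cast hN0.card_pos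
  have hn' : (1 : ℝ) ≤ n := by exact_mod_cast hn
  have hμ : 1 ≤ ManifoldBalls.muParam n N := by
    have h1 := Real.log_nonneg hcard
    have h2 := Real.log_nonneg hn'
    rw [ManifoldBalls.muParam]
    linarith
  have hconf : ManifoldBalls.confConst 32 δ = 64 * Real.log (2 / δ) := by
    rw [ManifoldBalls.confConst]; norm_num
  have hc : 1 ≤ ManifoldBalls.confConst 32 δ := by
    rw [hconf]
    linarith [ManifoldBalls.half_le_log_two_div hδ hδ1]
  obtain ⟨E, hE, hEδ, hEx⟩ := ManifoldBalls.exists_good_event (P := P) hn hμ hk hc N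
  refine ⟨E, hE, lt_of_lt_of_le ?_ hEδ, ?_⟩
  · have := ManifoldBalls.card_mul_tailBound_lt hcard hn' hδ hδ1
    rw [hconf, ManifoldBalls.muParam]
    linarith
  · rintro x hx B ⟨z, hz, hB⟩
    exact hEx x hx z hz B hB
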